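/- Let $\mathbb K=\mathbb R$ or $\mathbb C$ and let $M$ be an $n$-dimensional generalized Frobenius manifold with non-flat unity over $\mathbb K$: a smooth (for $\mathbb K=\mathbb C$ holomorphic) manifold with a smooth family of Frobenius algebra structures $(\cdot,\langle\ ,\ \rangle,e)$ on its tangent spaces (commutative, associative, with unity $e$ and with a nondegenerate symmetric invariant bilinear form) such that: the metric $\eta=\langle\ ,\ \rangle$ is flat, and $\nabla e\not\equiv0$ for its Levi-Civita connection $\nabla$; with $c(u,v,w)=\langle u\cdot v,w\rangle$, the 4-tensor $\nabla c$ is symmetric; there are a vector field $E$ and a constant $d$ with $\nabla\nabla E=0$, $\nabla E$ diagonalizable, $\mathcal L_E(a\cdot b)=\mathcal L_Ea\cdot b+a\cdot\mathcal L_Eb+a\cdot b$ and $\mathcal L_E\langle a,b\rangle=\langle\mathcal L_Ea,b\rangle+\langle a,\mathcal L_Eb\rangle+(2-d)\langle a,b\rangle$. Let $v^1,\dots,v^n$ be flat coordinates on an open subset of $M$ in which $\mu:=\frac{2-d}2-\nabla E=\mathrm{diag}(\mu_1,\dots,\mu_n)$, put $\partial_\alpha=\partial/\partial v^\alpha$,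 $\eta=(\langle\partial_\alpha,\partial_\beta\rangle)$, $\partial_\alpha\cdot\partial_\beta=c^\gamma_{\alpha\beta}\partial_\gamma$, and let $\mathcal U^\alpha_\beta=E^\gamma c^\alpha_{\gamma\beta}$ be the matrix of multiplication by $E$. Let $(\theta_1(v;z),\dots,\theta_n(v;z))z^\mu z^R$, $\theta_\alpha(v;z)=\sum_{p\ge0}\theta_{\alpha,p}(v)z^p$, be a normalized system of deformed flat coordinates. This means that $\theta_{\alpha,p}$ are smooth complex-valued functions and $R=R_1+\dots+R_m$ is a constant complex matrix (with $R_s=0$ for $s>m$) such that $(R_s)^\alpha_\beta=0$ unless $\mu_\alpha-\mu_\beta=s$, $R_s^{T}\eta=(-1)^{s+1}\eta R_s$, and the gradients $\xi_{\alpha,p}=\nabla\theta_{\alpha,p}$ with respect to $\eta$ satisfy $$\partial_\alpha\xi^\gamma_{\beta,p+1}=c^\gamma_{\alpha\sigma}\xi^\sigma_{\beta,p},\qquad \partial_E\xi_{\alpha,p}=(p+\mu_\alpha-\mu)\xi_{\alpha,p}+\sum_{s=1}^p(R_s)^\gamma_\alpha\xi_{\gamma,p-s},\qquad \xi_{\alpha,0}=\partial_\alpha,$$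 $$\Big\langle\sum_p\xi_{\alpha,p}(-z)^p,\sum_q\xi_{\beta,q}z^q\Big\rangle=\eta_{\alpha\beta}.$$ The regularized periods are $$(p^{(\nu)}_1,\dots,p^{(\nu)}_n)(v;\lambda)=\int_0^\infty\frac{dz}{\sqrt z}e^{-\lambda z}(\theta_1(v;z),\dots,\theta_n(v;z))z^{\mu+\nu}z^R,$$ understood as formal series in $\lambda$ (in complex powers of $\lambda$ with coefficients polynomial in $\log\lambda$) through $$\int_0^\infty e^{-\lambda z}z^{p+\mu+\nu-\frac12}z^R\,dz:=\sum_{s\ge0}\big[e^{R\partial_\nu}\big]_s\Gamma\big(p+\mu+\nu+s+\tfrac12\big)\lambda^{-(p+\mu+\nu+s+\frac12)}\lambda^{-R},$$ where $\lambda^{-R}=e^{-R\log\lambda}$ and $[A]_s=\sum_{\kappa\in\mathrm{Spec}\,\mu}\pi_{\kappa+s}A\pi_\kappa$, with $\pi_\kappa$ the projection to the $\kappa$-eigenspace of $\mu$. Let $P^{(\nu)}=(\nabla p^{(\nu)}_1,\dots,\nabla p^{(\nu)}_n)$, the gradients (with respect to $\eta$) being taken coefficientwise, and let $$G(\nu)=-\frac1{2\pi}\Big(e^{\pi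 iR}e^{\pi i(\mu+\nu)}+e^{-\pi iR}e^{-\pi i(\mu+\nu)}\Big)\eta^{-1}.$$ Then for every point $v$ of the coordinate domain and every $\nu\in\mathbb C$ with $\mu_\alpha+\nu+\frac12\notin\mathbb Z$ for all $\alpha$, the matrix $G(\nu)$ is invertible and $$\big(P^{(-\nu)}\big)^{T}\,\eta\,(\mathcal U-\lambda I)\,P^{(\nu)}=G(\nu)^{-1}$$ as matrices of formal series in $\lambda$. Equivalently, $G(\nu)$ is the Gram matrix $\big((P^{(-\nu)})^{T}\eta(\mathcal U-\lambda I)P^{(\nu)}\big)^{-1}$ of the twisted periods. -/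

import Mathlib

open scoped Manifold ContDiff ComplexOrder Polynomial

noncomputable section

namespace FrobMfd

/-! ## Generalized Frobenius manifolds

`𝕜` is `ℝ` or `ℂ` and `M` is an `n`-dimensional manifold over `𝕜` of class `C^∞`
(holomorphic if `𝕜 = ℂ`).  Tensor fields are given intrinsically on the tangent spaces;
the differential conditions are stated through the components in an arbitrary chart of the
maximal atlas. -/

section Geometry

variable (𝕜 : Type*) [RCLike 𝕜] (n : ℕ) (M : Type*) [TopologicalSpace M]
  [ChartedSpace (Fin n → 𝕜) M]

/-- A Frobenius algebra structure on every tangent space, together with a vector field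
(the Euler vector field) and a constant (the charge). -/
structure FrobeniusField where
  metric : ∀ x : M, TangentSpace 𝓘(𝕜, Fin n → 𝕜) x →ₗ[𝕜] TangentSpace 𝓘(𝕜, Fin n → 𝕜) x →ₗ[𝕜] 𝕜
  mul : ∀ x : M, TangentSpace 𝓘(𝕜, Fin n → 𝕜) x →ₗ[𝕜]
    TangentSpace 𝓘(𝕜, Fin n → 𝕜) x →ₗ[𝕜] TangentSpace 𝓘(𝕜, Fin n → 𝕜) x
  unit : ∀ x : M, TangentSpace 𝓘(𝕜, Fin n → 𝕜) x
  euler : ∀ x : M, TangentSpace 𝓘(𝕜, Fin n → 𝕜) x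
  charge : 𝕜
  mul_comm : ∀ x a b, mul x a b = mul x b a
  mul_assoc : ∀ x a b c, mul x (mul x a b) c = mul x a (mul x b c)
  unit_mul : ∀ x a, mul x (unit x) a = a
  metric_symm : ∀ x a b, metric x a b = metric x b a
  metric_nondegenerate : ∀ x a, (∀ b, metric x a b = 0) → a = 0
  metric_invariant : ∀ x a b c, metric x (mul x a b) c = metric x a (mul x b c)

variable {𝕜 n M}

/-- Partial derivative `∂_α f` at `y` of a function of the coordinates. -/
def pd {V : Type*} [NormedAddCommGroup V] [NormedSpace 𝕜 V]
    (α : Fin n) (f : (Fin n → 𝕜) → V) (y : Fin n → 𝕜) : V :=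
  fderiv 𝕜 f y (Pi.single α 1)

/-- The coordinate vector `∂_α` of the chart `φ` at the point with coordinates `y`. -/
def coordVec (φ : OpenPartialHomeomorph M (Fin n → 𝕜)) (y : Fin n → 𝕜) (α : Fin n) :
    TangentSpace 𝓘(𝕜, Fin n → 𝕜) (φ.symm y) :=
  mfderiv 𝓘(𝕜, Fin n → 𝕜) 𝓘(𝕜, Fin n → 𝕜) φ.symm y
    (Pi.single α 1 : Fin n → 𝕜)

/-- The components in the chart `φ` of a tangent vector at the point with coordinates `y`. -/
def components (φ : OpenPartialHomeomorph M (Fin n → 𝕜)) (y : Fin n → 𝕜)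
    (w : TangentSpace 𝓘(𝕜, Fin n → 𝕜) (φ.symm y)) : Fin n → 𝕜 :=
  mfderiv 𝓘(𝕜, Fin n → 𝕜) 𝓘(𝕜, Fin n → 𝕜) φ (φ.symm y) w

namespace FrobeniusField

variable (F : FrobeniusField 𝕜 n M) (φ : OpenPartialHomeomorph M (Fin n → 𝕜))

/-- `η_{αβ} = ⟨∂_α, ∂_β⟩`. -/
def gram (y : Fin n → 𝕜) : Matrix (Fin n) (Fin n) 𝕜 :=
  Matrix.of fun α β => F.metric (φ.symm y) (coordVec φ y α) (coordVec φ y β)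

/-- The structure functions: `∂_α · ∂_β = c^γ_{αβ} ∂_γ`, with `F.structConst φ y γ α β = c^γ_{αβ}`. -/
def structConst (y : Fin n → 𝕜) (γ α β : Fin n) : 𝕜 :=
  components φ y (F.mul (φ.symm y) (coordVec φ y α) (coordVec φ y β)) γ

/-- The components `e^α` of the unity. -/
def unitComp (y : Fin n → 𝕜) : Fin n → 𝕜 := components φ y (F.unit (φ.symm y))

/-- The components `E^α` of the Euler vector field. -/
def eulerComp (y : Fin n → 𝕜) : Fin n → 𝕜 := components φ y (F.euler (φ.symm y))

/-- The Christoffel symbols `Γ^γ_{αβ}` of the Levi-Civita connection of the metric. -/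
def christoffel (y : Fin n → 𝕜) (γ α β : Fin n) : 𝕜 :=
  (1 / 2) * ∑ δ, (F.gram φ y)⁻¹ γ δ *
    (pd α (fun w => F.gram φ w δ β) y + pd β (fun w => F.gram φ w δ α) y
      - pd δ (fun w => F.gram φ w α β) y)

/-- The curvature `∂_α Γ^δ_{βγ} - ∂_β Γ^δ_{αγ} + Γ^δ_{αε} Γ^ε_{βγ} - Γ^δ_{βε} Γ^ε_{αγ}`. -/
def curvature (y : Fin n → 𝕜) (δ γ α β : Fin n) : 𝕜 :=
  pd α (fun w => F.christoffel φ w δ β γ) y - pd β (fun w => F.christoffel φ w δ α γ) y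
    + ∑ ε, (F.christoffel φ y δ α ε * F.christoffel φ y ε β γ
      - F.christoffel φ y δ β ε * F.christoffel φ y ε α γ)

/-- The covariant derivative of a vector field `X` given by components:
the matrix with entry `(∇_β X)^γ = ∂_β X^γ + Γ^γ_{βε} X^ε` in row `γ` and column `β`. -/
def nablaVec (X : (Fin n → 𝕜) → (Fin n → 𝕜)) (y : Fin n → 𝕜) : Matrix (Fin n) (Fin n) 𝕜 :=
  Matrix.of fun γ β => pd β (fun w => X w γ) y + ∑ ε, F.christoffel φ y γ β ε * X y ε

/-- `(∇_α ∇E)^γ_β`. -/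
def nablaNablaEuler (y : Fin n → 𝕜) (γ α β : Fin n) : 𝕜 :=
  pd α (fun w => F.nablaVec φ (F.eulerComp φ) w γ β) y
    + ∑ ε, (F.christoffel φ y γ α ε * F.nablaVec φ (F.eulerComp φ) y ε β
      - F.christoffel φ y ε α β * F.nablaVec φ (F.eulerComp φ) y γ ε)

/-- The 3-tensor `c(∂_α, ∂_β, ∂_γ) = ⟨∂_α · ∂_β, ∂_γ⟩`. -/
def cLow (y : Fin n → 𝕜) (α β γ : Fin n) : 𝕜 :=
  F.metric (φ.symm y) (F.mul (φ.symm y) (coordVec φ y α) (coordVec φ y β)) (coordVec φ y γ)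

/-- The 4-tensor `(∇_{∂_δ} c)(∂_α, ∂_β, ∂_γ)`. -/
def nablaC (y : Fin n → 𝕜) (δ α β γ : Fin n) : 𝕜 :=
  pd δ (fun w => F.cLow φ w α β γ) y
    - ∑ ε, (F.christoffel φ y ε δ α * F.cLow φ y ε β γ
      + F.christoffel φ y ε δ β * F.cLow φ y α ε γ
      + F.christoffel φ y ε δ γ * F.cLow φ y α β ε)

/-- The `γ`-th component of `(𝓛_E ·)(∂_α, ∂_β)
= 𝓛_E(∂_α · ∂_β) - (𝓛_E ∂_α) · ∂_β - ∂_α · (𝓛_E ∂_β)`. -/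
def lieMul (y : Fin n → 𝕜) (γ α β : Fin n) : 𝕜 :=
  fderiv 𝕜 (fun w => F.structConst φ w γ α β) y (F.eulerComp φ y)
    + ∑ ε, (- pd ε (fun w => F.eulerComp φ w γ) y * F.structConst φ y ε α β
      + pd α (fun w => F.eulerComp φ w ε) y * F.structConst φ y γ ε β
      + pd β (fun w => F.eulerComp φ w ε) y * F.structConst φ y γ α ε)

/-- `(𝓛_E η)(∂_α, ∂_β) = 𝓛_E⟨∂_α, ∂_β⟩ - ⟨𝓛_E ∂_α, ∂_β⟩ - ⟨∂_α, 𝓛_E ∂_β⟩`. -/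
def lieMetric (y : Fin n → 𝕜) (α β : Fin n) : 𝕜 :=
  fderiv 𝕜 (fun w => F.gram φ w α β) y (F.eulerComp φ y)
    + ∑ ε, (pd α (fun w => F.eulerComp φ w ε) y * F.gram φ y ε β
      + pd β (fun w => F.eulerComp φ w ε) y * F.gram φ y α ε)

/-- The operator `𝒰` of multiplication by `E`: `𝒰^α_β = E^γ c^α_{γβ}`. -/
def multEuler (y : Fin n → 𝕜) : Matrix (Fin n) (Fin n) 𝕜 :=
  Matrix.of fun α β => ∑ γ, F.eulerComp φ y γ * F.structConst φ y α γ β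

end FrobeniusField

variable (𝕜 n M) in
/-- A generalized Frobenius manifold with non-flat unity. -/
structure GeneralizedFrobeniusManifold [IsManifold 𝓘(𝕜, Fin n → 𝕜) ∞ M] extends
    FrobeniusField 𝕜 n M where
  smooth_gram : ∀ φ ∈ IsManifold.maximalAtlas 𝓘(𝕜, Fin n → 𝕜) ∞ M, ∀ α β,
    ContDiffOn 𝕜 ∞ (fun y => toFrobeniusField.gram φ y α β) φ.target
  smooth_structConst : ∀ φ ∈ IsManifold.maximalAtlas 𝓘(𝕜, Fin n → 𝕜) ∞ M, ∀ γ α β,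
    ContDiffOn 𝕜 ∞ (fun y => toFrobeniusField.structConst φ y γ α β) φ.target
  smooth_unit : ∀ φ ∈ IsManifold.maximalAtlas 𝓘(𝕜, Fin n → 𝕜) ∞ M,
    ContDiffOn 𝕜 ∞ (toFrobeniusField.unitComp φ) φ.target
  smooth_euler : ∀ φ ∈ IsManifold.maximalAtlas 𝓘(𝕜, Fin n → 𝕜) ∞ M,
    ContDiffOn 𝕜 ∞ (toFrobeniusField.eulerComp φ) φ.target
  /-- the metric is flat -/
  flat : ∀ φ ∈ IsManifold.maximalAtlas 𝓘(𝕜, Fin n → 𝕜) ∞ M, ∀ y ∈ φ.target, ∀ δ γ α β,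
    toFrobeniusField.curvature φ y δ γ α β = 0
  /-- `∇e` does not vanish identically -/
  unit_not_flat : ∃ φ ∈ IsManifold.maximalAtlas 𝓘(𝕜, Fin n → 𝕜) ∞ M, ∃ y ∈ φ.target,
    toFrobeniusField.nablaVec φ (toFrobeniusField.unitComp φ) y ≠ 0
  /-- the 4-tensor `∇c` is symmetric -/
  nablaC_symm : ∀ φ ∈ IsManifold.maximalAtlas 𝓘(𝕜, Fin n → 𝕜) ∞ M, ∀ y ∈ φ.target,
    ∀ (i : Fin 4 → Fin n) (σ : Equiv.Perm (Fin 4)),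
    toFrobeniusField.nablaC φ y (i (σ 0)) (i (σ 1)) (i (σ 2)) (i (σ 3))
      = toFrobeniusField.nablaC φ y (i 0) (i 1) (i 2) (i 3)
  /-- `∇∇E = 0` -/
  nabla_nabla_euler : ∀ φ ∈ IsManifold.maximalAtlas 𝓘(𝕜, Fin n → 𝕜) ∞ M, ∀ y ∈ φ.target,
    ∀ γ α β, toFrobeniusField.nablaNablaEuler φ y γ α β = 0
  /-- `∇E` is diagonalizable -/
  nabla_euler_diagonalizable : ∀ φ ∈ IsManifold.maximalAtlas 𝓘(𝕜, Fin n → 𝕜) ∞ M,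
    ∀ y ∈ φ.target, ∃ (B : Matrix (Fin n) (Fin n) 𝕜) (D : Fin n → 𝕜), IsUnit B.det ∧
      toFrobeniusField.nablaVec φ (toFrobeniusField.eulerComp φ) y * B = B * Matrix.diagonal D
  /-- `𝓛_E(a·b) = 𝓛_E a · b + a · 𝓛_E b + a·b` -/
  lie_mul : ∀ φ ∈ IsManifold.maximalAtlas 𝓘(𝕜, Fin n → 𝕜) ∞ M, ∀ y ∈ φ.target, ∀ γ α β,
    toFrobeniusField.lieMul φ y γ α β = toFrobeniusField.structConst φ y γ α β
  /-- `𝓛_E⟨a,b⟩ = ⟨𝓛_E a,b⟩ + ⟨a,𝓛_E b⟩ + (2-d)⟨a,b⟩` -/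
  lie_metric : ∀ φ ∈ IsManifold.maximalAtlas 𝓘(𝕜, Fin n → 𝕜) ∞ M, ∀ y ∈ φ.target, ∀ α β,
    toFrobeniusField.lieMetric φ y α β = (2 - charge) * toFrobeniusField.gram φ y α β

variable [IsManifold 𝓘(𝕜, Fin n → 𝕜) ∞ M]

/-- A chart of flat coordinates `v^1, …, v^n` of the flat metric in which
`μ = (2-d)/2 - ∇E` is diagonal. -/
structure FlatChart (F : GeneralizedFrobeniusManifold 𝕜 n M) where
  chart : OpenPartialHomeomorph M (Fin n → 𝕜)
  mem_maximalAtlas : chart ∈ IsManifold.maximalAtlas 𝓘(𝕜, Fin n → 𝕜) ∞ M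
  η : Matrix (Fin n) (Fin n) 𝕜
  gram_eq : ∀ v ∈ chart.target, F.gram chart v = η
  μ : Fin n → 𝕜
  mu_eq : ∀ v ∈ chart.target,
    ((2 - F.charge) / 2) • (1 : Matrix (Fin n) (Fin n) 𝕜)
      - F.nablaVec chart (F.eulerComp chart) v = Matrix.diagonal μ

/-! ## Complexified coefficients

The monodromy data, the deformed flat coordinates and the periods are complex valued.
The field `𝕜` acts on `ℂ` by an algebra structure `𝕜 → ℂ`. -/

variable [NormedAlgebra 𝕜 ℂ] {F : GeneralizedFrobeniusManifold 𝕜 n M}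

namespace FlatChart

variable (φ : FlatChart F)

/-- The complex matrix `(η_{αβ})`. -/
def etaC : Matrix (Fin n) (Fin n) ℂ := φ.η.map (algebraMap 𝕜 ℂ)

/-- The complex numbers `μ_1, …, μ_n`. -/
def muC (α : Fin n) : ℂ := algebraMap 𝕜 ℂ (φ.μ α)

/-- The complex matrix of the operator `𝒰` at the point with flat coordinates `v`. -/
def multEulerC (v : Fin n → 𝕜) : Matrix (Fin n) (Fin n) ℂ :=
  (F.multEuler φ.chart v).map (algebraMap 𝕜 ℂ)

/-- The gradient with respect to the flat metric: `(∇f)^γ = η^{γδ} ∂_δ f`. -/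
def gradient (f : (Fin n → 𝕜) → ℂ) (v : Fin n → 𝕜) (γ : Fin n) : ℂ :=
  ∑ δ, φ.etaC⁻¹ γ δ * pd δ f v

/-- The matrix `Θ_p = (∇θ_{1,p}, …, ∇θ_{n,p})`, i.e. `ξ^γ_{α,p}` in row `γ`, column `α`. -/
def gradMatrix (θ : ℕ → Fin n → (Fin n → 𝕜) → ℂ) (p : ℕ) (v : Fin n → 𝕜) :
    Matrix (Fin n) (Fin n) ℂ :=
  Matrix.of fun γ α => φ.gradient (θ p α) v γ

end FlatChart

/-- A normalized system of deformed flat coordinates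
`(θ_1(v;z), …, θ_n(v;z)) z^μ z^R` with `θ_α(v;z) = ∑_p θ_{α,p}(v) z^p` (here `θ p α = θ_{α,p}`),
together with the matrix `R = R_1 + ⋯ + R_m`. -/
structure DeformedFlatCoordinates (φ : FlatChart F) where
  θ : ℕ → Fin n → (Fin n → 𝕜) → ℂ
  smooth : ∀ p α, ContDiffOn 𝕜 ∞ (θ p α) φ.chart.target
  m : ℕ
  Rpart : ℕ → Matrix (Fin n) (Fin n) ℂ
  Rpart_eq_zero : ∀ s, m < s → Rpart s = 0
  Rpart_degree : ∀ s : ℕ, 1 ≤ s → ∀ α β, φ.muC α - φ.muC β ≠ s → Rpart s α β = 0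
  Rpart_eta : ∀ s : ℕ, 1 ≤ s → (Rpart s).transpose * φ.etaC = (-1 : ℂ) ^ (s + 1) • (φ.etaC * Rpart s)
  /-- `∂_α ξ^γ_{β,p+1} = c^γ_{ασ} ξ^σ_{β,p}` -/
  recursion : ∀ v ∈ φ.chart.target, ∀ p α β γ,
    pd α (fun w => φ.gradMatrix θ (p + 1) w γ β) v
      = ∑ σ, algebraMap 𝕜 ℂ (F.structConst φ.chart v γ α σ) * φ.gradMatrix θ p v σ β
  /-- `∂_E ξ_{α,p} = (p + μ_α - μ) ξ_{α,p} + ∑_{s=1}^p (R_s)^γ_α ξ_{γ,p-s}` -/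
  quasihomogeneity : ∀ v ∈ φ.chart.target, ∀ p α γ,
    fderiv 𝕜 (fun w => φ.gradMatrix θ p w γ α) v (F.eulerComp φ.chart v)
      = (p + φ.muC α - φ.muC γ) * φ.gradMatrix θ p v γ α
        + ∑ s ∈ Finset.Icc 1 p, ∑ δ, Rpart s δ α * φ.gradMatrix θ (p - s) v γ δ
  /-- `ξ_{α,0} = ∂_α` -/
  normalized : ∀ v ∈ φ.chart.target, φ.gradMatrix θ 0 v = 1
  /-- `⟨ξ_α(v;-z), ξ_β(v;z)⟩ = η_{αβ}`, coefficientwise in `z` -/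
  orthogonality : ∀ v ∈ φ.chart.target, ∀ k : ℕ,
    ∑ pq ∈ Finset.HasAntidiagonal.antidiagonal k, (-1 : ℂ) ^ pq.1 •
      ((φ.gradMatrix θ pq.1 v).transpose * φ.etaC * φ.gradMatrix θ pq.2 v)
      = if k = 0 then φ.etaC else 0

end Geometry

/-! ## Formal series in `λ` and the formal Laplace integral -/

section Laplace

/-- Formal series in complex powers of `λ` with coefficients polynomial in `log λ`:
`HahnSeries.single a f` is `f(log λ) λ^{-a}`.  Supports are partially well-ordered for
`a ≤ b ↔ b - a ∈ [0,∞)`. -/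
abbrev LambdaSeries : Type := HahnSeries ℂ ℂ[X]

/-- The formal variable `λ`. -/
def lam : LambdaSeries := HahnSeries.single (-1) 1

/-- The constants, as a ring homomorphism. -/
def const : ℂ →+* LambdaSeries := HahnSeries.C.comp Polynomial.C

variable {n : ℕ} (μ : Fin n → ℂ) (R : Matrix (Fin n) (Fin n) ℂ)

/-- The component `[A]_s = ∑_{κ ∈ Spec μ} π_{κ+s} A π_κ`, for `μ` diagonal. -/
def degreePart (s : ℕ) (A : Matrix (Fin n) (Fin n) ℂ) : Matrix (Fin n) (Fin n) ℂ :=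
  Matrix.of fun α β => if μ α = μ β + s then A α β else 0

/-- `[e^{R ∂_ν}]_s Γ(a + μ + ν)`; the exponential series terminates since `R` is nilpotent. -/
def expGamma (s : ℕ) (a ν : ℂ) : Matrix (Fin n) (Fin n) ℂ :=
  ∑ k ∈ Finset.range (nilpotencyClass R), ((k.factorial : ℂ))⁻¹ •
    (degreePart μ s (R ^ k) *
      Matrix.diagonal fun β => iteratedDeriv k (fun ν' : ℂ => Complex.Gamma (a + μ β + ν')) ν)

/-- `λ^{-R} = e^{-R log λ}`, with `log λ` the polynomial variable. -/
def lamPowNegR : Matrix (Fin n) (Fin n) ℂ[X] :=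
  IsNilpotent.exp (-((Polynomial.X : ℂ[X]) • R.map Polynomial.C))

/-- The formal Laplace integral
`∫_0^∞ z^{-1/2} e^{-λz} (∑_p f_p z^p) z^{μ+ν} z^R dz` of a sequence of row vectors `f_p`,
which by definition is the formal series
`∑_{p,s} f_p [e^{R∂_ν}]_s Γ(p+μ+ν+s+1/2) λ^{-(p+μ+ν+s+1/2)} λ^{-R}`;
the terms are collected according to `q = p + s`. -/
def formalLaplace (f : ℕ → Fin n → ℂ) (ν : ℂ) : Fin n → LambdaSeries :=
  Matrix.vecMul
    (fun β => HahnSeries.ofPowerSeries ℂ ℂ[X] (PowerSeries.mk fun q => Polynomial.C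
      ((∑ ps ∈ Finset.HasAntidiagonal.antidiagonal q,
        Matrix.vecMul (f ps.1) (expGamma μ R ps.2 (q + 1 / 2) ν)) β)))
    ((Matrix.diagonal fun β => HahnSeries.single (μ β + ν + 1 / 2) (1 : ℂ[X])) *
      (lamPowNegR R).map HahnSeries.C)

/-- Every coefficient of a formal Laplace integral is a finite linear combination of the `f_p`. -/
theorem formalLaplace_coeff {n : ℕ} (μ : Fin n → ℂ) (R : Matrix (Fin n) (Fin n) ℂ) (ν : ℂ)
    (β : Fin n) (a : ℂ) (k : ℕ) :
    ∃ (N : ℕ) (w : ℕ → Fin n → ℂ), ∀ f : ℕ → Fin n → ℂ,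
      ((formalLaplace μ R f ν β).coeff a).coeff k
        = ∑ p ∈ Finset.range N, ∑ α, w p α * f p α := by
  have key : ∀ β' : Fin n, ∃ (N : ℕ) (w : ℕ → Fin n → ℂ), ∀ f : ℕ → Fin n → ℂ,
      ((HahnSeries.ofPowerSeries ℂ ℂ[X] (PowerSeries.mk fun q => Polynomial.C
      ((∑ ps ∈ Finset.HasAntidiagonal.antidiagonal q,
        Matrix.vecMul (f ps.1) (expGamma μ R ps.2 (q + 1 / 2) ν)) β'))
        * ((Matrix.diagonal fun β => HahnSeries.single (μ β + ν + 1 / 2) (1 : ℂ[X])) *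
      (lamPowNegR R).map HahnSeries.C : Matrix (Fin n) (Fin n) LambdaSeries) β' β).coeff a).coeff k
        = ∑ p ∈ Finset.range N, ∑ α, w p α * f p α := by
    intro β'
    set b := μ β' + ν + 1 / 2 with hb
    set g := lamPowNegR R β' β with hg
    have h1 : ((Matrix.diagonal fun β => HahnSeries.single (μ β + ν + 1 / 2) (1 : ℂ[X])) *
      (lamPowNegR R).map HahnSeries.C : Matrix (Fin n) (Fin n) LambdaSeries) β' β
        = HahnSeries.single b g := by
      rw [Matrix.diagonal_mul, Matrix.map_apply, HahnSeries.C_apply, HahnSeries.single_mul_single]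
      simp [hb, hg]
    have h2 : ∀ A : LambdaSeries, (A * HahnSeries.single b g).coeff a = A.coeff (a - b) * g := by
      intro A
      conv_lhs => rw [show a = (a - b) + b by ring]
      rw [HahnSeries.coeff_mul_single_add]
    simp only [h1, h2]
    by_cases hq : ∃ q : ℕ, (q : ℂ) = a - b
    · obtain ⟨q, hq⟩ := hq
      refine ⟨q + 1, fun p α => expGamma μ R (q - p) (q + 1 / 2) ν α β' * g.coeff k, fun f => ?_⟩
      rw [← hq, HahnSeries.ofPowerSeries_apply_coeff, PowerSeries.coeff_mk,
        Polynomial.coeff_C_mul, Finset.sum_apply, Finset.sum_mul,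
        Finset.Nat.sum_antidiagonal_eq_sum_range_succ_mk]
      refine Finset.sum_congr rfl fun p _ => ?_
      simp only [Matrix.vecMul, dotProduct, Finset.sum_mul]
      exact Finset.sum_congr rfl fun α _ => by ring
    · refine ⟨0, 0, fun f => ?_⟩
      rw [HahnSeries.ofPowerSeries_apply, HahnSeries.embDomain_of_notMem_range]
      · simp
      · rintro ⟨q, h⟩
        exact hq ⟨q, h⟩
  choose N w h using key
  refine ⟨∑ β', N β', fun p α => ∑ β', if p < N β' then w β' p α else 0, fun f => ?_⟩
  rw [formalLaplace, Matrix.vecMul, dotProduct, HahnSeries.coeff_sum, Polynomial.finsetSum_coeff,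
    Finset.sum_congr rfl fun β' _ => h β' f]
  simp only [Finset.sum_mul]
  refine Eq.trans ?_ ((Finset.sum_congr rfl fun p _ => Finset.sum_comm).trans
    Finset.sum_comm).symm
  refine Finset.sum_congr rfl fun β' _ => ?_
  have hN : Finset.range (N β') ⊆ Finset.range (∑ β', N β') :=
    Finset.range_subset_range.2 (Finset.single_le_sum (f := N) (fun _ _ => Nat.zero_le _)
      (Finset.mem_univ β'))
  rw [← Finset.sum_subset hN]
  · refine Finset.sum_congr rfl fun p hp => Finset.sum_congr rfl fun α _ => ?_
    rw [if_pos (Finset.mem_range.1 hp)]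
  · intro p _ hp
    simp only [if_neg (fun h => hp (Finset.mem_range.2 h)), zero_mul, Finset.sum_const_zero]

/-- `G(ν) = -(1/2π) (e^{πiR} e^{πi(μ+ν)} + e^{-πiR} e^{-πi(μ+ν)}) η^{-1}`. -/
def gramMatrix (η : Matrix (Fin n) (Fin n) ℂ) (ν : ℂ) : Matrix (Fin n) (Fin n) ℂ :=
  (-(1 / (2 * (Real.pi : ℂ)))) •
    ((NormedSpace.exp ((Real.pi * Complex.I) • R)
        * NormedSpace.exp ((Real.pi * Complex.I) • (Matrix.diagonal μ + ν • 1))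
      + NormedSpace.exp (-(Real.pi * Complex.I) • R)
        * NormedSpace.exp (-(Real.pi * Complex.I) • (Matrix.diagonal μ + ν • 1))) * η⁻¹)

end Laplace

/-! ## Regularized periods -/

section Periods

variable {𝕜 : Type*} [RCLike 𝕜] {n : ℕ} {M : Type*} [TopologicalSpace M]
  [ChartedSpace (Fin n → 𝕜) M] [IsManifold 𝓘(𝕜, Fin n → 𝕜) ∞ M] [NormedAlgebra 𝕜 ℂ]
  {F : GeneralizedFrobeniusManifold 𝕜 n M} {φ : FlatChart F}

namespace DeformedFlatCoordinates

variable (D : DeformedFlatCoordinates φ)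

/-- `R = R_1 + ⋯ + R_m`. -/
def R : Matrix (Fin n) (Fin n) ℂ := ∑ s ∈ Finset.Icc 1 D.m, D.Rpart s

/-- The regularized periods `(p_1^{(ν)}(v;λ), …, p_n^{(ν)}(v;λ))`. -/
def period (ν : ℂ) (v : Fin n → 𝕜) : Fin n → LambdaSeries :=
  formalLaplace φ.muC D.R (fun p α => D.θ p α v) ν

/-- The matrix `P^{(ν)} = (∇p_1^{(ν)}, …, ∇p_n^{(ν)})`; the gradient of a formal series is taken
coefficientwise (see `periodGradient_coeff`), i.e. under the formal Laplace integral. -/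
def periodGradient (ν : ℂ) (v : Fin n → 𝕜) : Matrix (Fin n) (Fin n) LambdaSeries :=
  Matrix.of fun γ => formalLaplace φ.muC D.R (fun p α => φ.gradMatrix D.θ p v γ α) ν

/-- The constant matrix `G(ν)`. -/
def G (ν : ℂ) : Matrix (Fin n) (Fin n) ℂ := gramMatrix φ.muC D.R φ.etaC ν

/-- Every coefficient of `P^{(ν)}` is the gradient of the corresponding coefficient of the
periods. -/
theorem periodGradient_coeff (ν : ℂ) (v : Fin n → 𝕜) (hv : v ∈ φ.chart.target) (γ β : Fin n)
    (a : ℂ) (k : ℕ) :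
    ((D.periodGradient ν v γ β).coeff a).coeff k
      = φ.gradient (fun w => ((D.period ν w β).coeff a).coeff k) v γ := by
  obtain ⟨N, w, h⟩ := formalLaplace_coeff φ.muC D.R ν β a k
  have hd : ∀ p α, DifferentiableAt 𝕜 (D.θ p α) v := fun p α =>
    ((D.smooth p α).contDiffAt (φ.chart.open_target.mem_nhds hv)).differentiableAt (by simp)
  simp only [periodGradient, period, Matrix.of_apply, h, FlatChart.gradient, FlatChart.gradMatrix,
    pd]
  have : ∀ δ : Fin n, fderiv 𝕜 (fun y => ∑ p ∈ Finset.range N, ∑ α, w p α * D.θ p α y) v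
      (Pi.single δ 1) = ∑ p ∈ Finset.range N, ∑ α, w p α *
        fderiv 𝕜 (D.θ p α) v (Pi.single δ 1) := by
    intro δ
    rw [fderiv_fun_sum fun p _ => DifferentiableAt.fun_sum fun α _ => (hd p α).const_mul _]
    rw [sum_apply]
    refine Finset.sum_congr rfl fun p _ => ?_
    rw [fderiv_fun_sum fun α _ => (hd p α).const_mul _, sum_apply]
    refine Finset.sum_congr rfl fun α _ => ?_
    rw [fderiv_const_mul (hd p α)]
    simp
  simp only [this, Finset.mul_sum]
  refine ((Finset.sum_congr rfl fun p _ => Finset.sum_comm).trans Finset.sum_comm).trans ?_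
  exact Finset.sum_congr rfl fun δ _ => Finset.sum_congr rfl fun p _ =>
    Finset.sum_congr rfl fun α _ => by ring

/-- `R` is nilpotent, so the exponential series in `R` above are finite sums. -/
theorem R_isNilpotent : IsNilpotent D.R := by
  classical
  have h1 : ∀ α β, D.R α β ≠ 0 → ∃ s : ℕ, 1 ≤ s ∧ φ.muC α - φ.muC β = s := by
    intro α β h
    by_contra! hc
    refine h ?_
    rw [R, Matrix.sum_apply]
    exact Finset.sum_eq_zero fun s hs => D.Rpart_degree s (Finset.mem_Icc.1 hs).1 _ _
      (hc s (Finset.mem_Icc.1 hs).1)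
  have h2 : ∀ k α β, (D.R ^ k) α β ≠ 0 → ∃ s : ℕ, k ≤ s ∧ φ.muC α - φ.muC β = s := by
    intro k
    induction k with
    | zero =>
      intro α β h
      rw [pow_zero, Matrix.one_apply] at h
      refine ⟨0, le_rfl, ?_⟩
      by_cases hαβ : α = β
      · simp [hαβ]
      · simp [hαβ] at h
    | succ k ih =>
      intro α β h
      rw [pow_succ, Matrix.mul_apply] at h
      obtain ⟨δ, -, hδ⟩ := Finset.exists_ne_zero_of_sum_ne_zero h
      obtain ⟨s, hs, e⟩ := ih α δ (left_ne_zero_of_mul hδ)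
      obtain ⟨t, ht, e'⟩ := h1 δ β (right_ne_zero_of_mul hδ)
      exact ⟨s + t, by omega, by push_cast; rw [← e, ← e']; ring⟩
  obtain ⟨K, hK⟩ := exists_nat_gt (∑ α, ∑ β, ‖φ.muC α - φ.muC β‖)
  refine ⟨K, ?_⟩
  ext α β
  by_contra h
  obtain ⟨s, hs, e⟩ := h2 K α β h
  have h3 : ‖φ.muC α - φ.muC β‖ ≤ ∑ α, ∑ β, ‖φ.muC α - φ.muC β‖ :=
    (Finset.single_le_sum (f := fun β => ‖φ.muC α - φ.muC β‖) (fun _ _ => norm_nonneg _)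
      (Finset.mem_univ β)).trans
    (Finset.single_le_sum (f := fun α => ∑ β, ‖φ.muC α - φ.muC β‖)
      (fun _ _ => Finset.sum_nonneg fun _ _ => norm_nonneg _) (Finset.mem_univ α))
  rw [e, Complex.norm_natCast] at h3
  have : (K : ℝ) ≤ s := by exact_mod_cast hs
  linarith
end DeformedFlatCoordinates

end Periods

end FrobMfd

end

/-! Put Θ(z) = ∑ Θ_p z^p with Θ_p = (ξ_{1,p}, …, ξ_{n,p}), and R(z) = ∑ R_s z^s. Contracting the
recursion for ξ with E turns ∂_E Θ into z𝒰Θ, so quasi-homogeneity becomes an equation at a single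
point v, namely z𝒰Θ = zΘ' + Θμ - μΘ + ΘR(z) (`isEulerSystem`). Everything after that is matrix
algebra at v.

The Laplace coefficients of P^{(ν)} are generalized by freeing the argument c of the Gamma function
from the summation index q (`laplaceCoeff`). The equation for Θ and Γ(x+1) = xΓ(x) then give a
recursion linking c, c+1 and q-1, q (`laplaceCoeff_recursion`). In the pairing of coefficients for
-ν and ν the scalar terms of two such recursions cancel, and so do the μ-terms, since μ is η-skew.
What remains telescopes (`telescope`, `laplaceCoeff_pairing`) to an alternating sum in which both
values of c are fixed, k on the left and 0 on the right. With c fixed, orthogonality of Θ removes Θ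
altogether (`sum_laplaceCoeff_eq_of_orthogonal`), and a sum of products of Gamma derivatives is
left. It is the Taylor expansion in R of Γ(1/2+μ+ν)Γ(1/2-μ-ν) = π/cos π(μ+ν)
(`sum_expGamma_pairing`).

On the other side G(ν) is, up to conjugation by e^{πiμ} and the factor η⁻¹, minus the cosine of
π(μ+ν+R) divided by π. Its inverse is therefore the same expansion of π/cos
(`gramMatrix_mul_gramInv`); conjugation by e^{πiμ} produces the sign (-1)^k in degree k.

Finally, skewness of μ makes the degree-k term live exactly where the powers of λ cancel
(`gramInv_apply`), and the factors λ^{-R} cancel because R is skew for the form G(ν)⁻¹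
(`gramMatrix_mul_transpose`, `lamPowNegR_isometry`). -/

noncomputable section

namespace FrobMfd

/-! ## Matrices graded by `μ` -/

section Graded

variable {n : ℕ} {μ : Fin n → ℂ} {A B R : Matrix (Fin n) (Fin n) ℂ}

/-- The nonzero entries of `A` have nonnegative integral degree with respect to `μ`. -/
def IsGraded (μ : Fin n → ℂ) (A : Matrix (Fin n) (Fin n) ℂ) : Prop :=
  ∀ α β, A α β ≠ 0 → ∃ s : ℕ, μ α = μ β + s

theorem IsGraded.one : IsGraded μ (1 : Matrix (Fin n) (Fin n) ℂ) := by
  intro α β h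
  by_cases hαβ : α = β
  · exact ⟨0, by simp [hαβ]⟩
  · simp [hαβ] at h

theorem IsGraded.mul (hA : IsGraded μ A) (hB : IsGraded μ B) : IsGraded μ (A * B) := by
  intro α β h
  rw [Matrix.mul_apply] at h
  obtain ⟨δ, -, hδ⟩ := Finset.exists_ne_zero_of_sum_ne_zero h
  obtain ⟨s, hs⟩ := hA α δ (left_ne_zero_of_mul hδ)
  obtain ⟨t, ht⟩ := hB δ β (right_ne_zero_of_mul hδ)
  exact ⟨s + t, by rw [hs, ht]; push_cast; ring⟩

theorem IsGraded.pow (hA : IsGraded μ A) (k : ℕ) : IsGraded μ (A ^ k) := by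
  induction k with
  | zero => simpa using IsGraded.one
  | succ k ih => rw [pow_succ]; exact ih.mul hA

theorem degreePart_apply (s : ℕ) (α β : Fin n) :
    degreePart μ s A α β = if μ α = μ β + s then A α β else 0 := rfl

/-- Gradedness is essential: a nonzero product A α δ * B δ β has well-defined degrees s and t, so it
is counted by exactly one pair of the antidiagonal. -/
theorem degreePart_mul (hA : IsGraded μ A) (hB : IsGraded μ B) (k : ℕ) :
    degreePart μ k (A * B) = ∑ p ∈ Finset.HasAntidiagonal.antidiagonal k,
      degreePart μ p.1 A * degreePart μ p.2 B := by
  ext α β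
  simp only [Matrix.sum_apply, Matrix.mul_apply, degreePart_apply]
  rw [Finset.sum_comm]
  have hl : (if μ α = μ β + k then ∑ δ, A α δ * B δ β else 0)
      = ∑ δ, if μ α = μ β + k then A α δ * B δ β else 0 := by
    split_ifs <;> simp
  rw [hl]
  refine Finset.sum_congr rfl fun δ _ => ?_
  by_cases h1 : A α δ = 0
  · simp [h1]
  by_cases h2 : B δ β = 0
  · simp [h2]
  obtain ⟨s, hs⟩ := hA α δ h1
  obtain ⟨t, ht⟩ := hB δ β h2
  have key : ∀ p : ℕ × ℕ, ((if μ α = μ δ + p.1 then A α δ else 0) *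
      (if μ δ = μ β + p.2 then B δ β else 0)) = if p = (s, t) then A α δ * B δ β else 0 := by
    intro p
    have e1 : μ α = μ δ + p.1 ↔ p.1 = s := by
      rw [hs, add_right_inj, Nat.cast_inj, eq_comm]
    have e2 : μ δ = μ β + p.2 ↔ p.2 = t := by
      rw [ht, add_right_inj, Nat.cast_inj, eq_comm]
    simp only [e1, e2, Prod.ext_iff]
    by_cases h1 : p.1 = s <;> by_cases h2 : p.2 = t <;> simp [h1, h2]
  simp only [key, Finset.sum_ite_eq', Finset.HasAntidiagonal.mem_antidiagonal]
  have e3 : μ α = μ β + k ↔ s + t = k := by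
    rw [hs, ht, add_assoc, add_right_inj, add_comm (t : ℂ), ← Nat.cast_add, Nat.cast_inj]
  simp only [e3]

/-- `f(μ + ν + R)` for a family of functions `f_β(ν) = f(μ_β + ν)`: the Taylor expansion in the
nilpotent matrix `R`. -/
def nilTaylor (R : Matrix (Fin n) (Fin n) ℂ) (f : Fin n → ℂ → ℂ) (ν : ℂ) :
    Matrix (Fin n) (Fin n) ℂ :=
  ∑ k ∈ Finset.range (nilpotencyClass R), ((k.factorial : ℂ))⁻¹ •
    (R ^ k * Matrix.diagonal fun β => iteratedDeriv k (f β) ν)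

theorem nilTaylor_apply (f : Fin n → ℂ → ℂ) (ν : ℂ) (α β : Fin n) :
    nilTaylor R f ν α β = ∑ k ∈ Finset.range (nilpotencyClass R),
      ((k.factorial : ℂ))⁻¹ * ((R ^ k) α β * iteratedDeriv k (f β) ν) := by
  simp [nilTaylor, Matrix.sum_apply]

theorem IsGraded.nilTaylor (hR : IsGraded μ R) (f : Fin n → ℂ → ℂ) (ν : ℂ) :
    IsGraded μ (nilTaylor R f ν) := by
  intro α β h
  rw [nilTaylor_apply] at h
  obtain ⟨k, -, hk⟩ := Finset.exists_ne_zero_of_sum_ne_zero h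
  exact hR.pow k α β (left_ne_zero_of_mul (right_ne_zero_of_mul hk))

/-- Terms with i + j at least the nilpotency class vanish; grouping the others by l = i + j turns
1/(i! j!) into a binomial coefficient over l!. The inner sum has the shape of the Leibniz rule, so
Taylor expansions in R multiply as the functions do. -/
theorem sum_sum_pow_of_nilpotent (hR : IsNilpotent R) (a b : ℕ → ℂ) (α β : Fin n) :
    ∑ i ∈ Finset.range (nilpotencyClass R), ∑ j ∈ Finset.range (nilpotencyClass R),
      ((i.factorial : ℂ))⁻¹ * ((j.factorial : ℂ))⁻¹ * (a i * b j) * (R ^ (i + j)) α β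
    = ∑ l ∈ Finset.range (nilpotencyClass R), ((l.factorial : ℂ))⁻¹ * ((R ^ l) α β *
        ∑ i ∈ Finset.range (l + 1), l.choose i * a i * b (l - i)) := by
  set N := nilpotencyClass R
  set F : ℕ × ℕ → ℂ := fun x => ((x.1.factorial : ℂ))⁻¹ * ((x.2.factorial : ℂ))⁻¹ *
    (a x.1 * b x.2) * (R ^ (x.1 + x.2)) α β with hF
  have h1 : ∑ i ∈ Finset.range N, ∑ j ∈ Finset.range N,
      ((i.factorial : ℂ))⁻¹ * ((j.factorial : ℂ))⁻¹ * (a i * b j) * (R ^ (i + j)) α β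
      = ∑ x ∈ (Finset.range N ×ˢ Finset.range N).filter (fun x => x.1 + x.2 < N), F x := by
    rw [← Finset.sum_product']
    refine (Finset.sum_filter_of_ne fun x _ hx => ?_).symm
    by_contra hlt
    refine hx ?_
    simp [pow_eq_zero_of_le (not_lt.1 hlt) (pow_nilpotencyClass hR)]
  rw [h1, ← Finset.sum_fiberwise_of_maps_to (t := Finset.range N) (g := fun x => x.1 + x.2)]
  · refine Finset.sum_congr rfl fun l hl => ?_
    have h2 : (Finset.filter (fun x => x.1 + x.2 = l)
        ((Finset.range N ×ˢ Finset.range N).filter (fun x => x.1 + x.2 < N)))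
        = Finset.HasAntidiagonal.antidiagonal l := by
      ext x
      have := Finset.mem_range.1 hl
      simp only [Finset.mem_filter, Finset.mem_product, Finset.mem_range, Finset.HasAntidiagonal.mem_antidiagonal]
      omega
    rw [h2, Finset.Nat.sum_antidiagonal_eq_sum_range_succ_mk, Finset.mul_sum, Finset.mul_sum]
    refine Finset.sum_congr rfl fun i hi => ?_
    have hi' : i ≤ l := Nat.lt_succ_iff.1 (Finset.mem_range.1 hi)
    rw [hF, Nat.cast_choose ℂ hi']
    simp only [Nat.add_sub_cancel' hi']
    have := Nat.cast_ne_zero (R := ℂ).2 l.factorial_ne_zero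
    field_simp
  · intro x hx
    simpa using (Finset.mem_filter.1 hx).2

end Graded

/-! ### Derivatives of the Gamma function away from its poles -/

section GammaDerivatives

theorem contDiffAt_Gamma {s : ℂ} (hs : ∀ m : ℕ, s ≠ -m) {k : WithTop ℕ∞} :
    ContDiffAt ℂ k Complex.Gamma s := by
  have h : ContDiffAt ℂ k (fun s : ℂ => ((Complex.Gamma s)⁻¹)⁻¹) s :=
    (Complex.differentiable_one_div_Gamma.contDiff.contDiffAt).inv
      (inv_ne_zero (Complex.Gamma_ne_zero hs))
  simpa using h

/-- Leibniz rule for Γ(z+1) = zΓ(z), where the linear factor has only two nonzero derivatives. At k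
= 0 the truncated k - 1 is harmless because of the factor k. -/
theorem iteratedDeriv_Gamma_add_one {s : ℂ} (hs : ∀ m : ℕ, s ≠ -m) (k : ℕ) :
    iteratedDeriv k Complex.Gamma (s + 1)
      = s * iteratedDeriv k Complex.Gamma s + k * iteratedDeriv (k - 1) Complex.Gamma s := by
  have h0 : s ≠ 0 := by simpa using hs 0
  rw [← congrFun (iteratedDeriv_comp_add_const k Complex.Gamma 1) s]
  have h1 : (fun z => Complex.Gamma (z + 1)) =ᶠ[nhds s] fun z => z * Complex.Gamma z := by
    filter_upwards [isOpen_ne.mem_nhds h0] with z hz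
    exact Complex.Gamma_add_one z hz
  rw [h1.iteratedDeriv_eq, iteratedDeriv_fun_mul (f := fun z => z) contDiffAt_id (contDiffAt_Gamma hs)]
  simp only [iteratedDeriv_fun_id]
  rcases k with _ | k
  · simp
  · rw [Finset.sum_range_succ', Finset.sum_range_succ']
    simp
    ring

end GammaDerivatives

/-! ### The functional equation of the matrix Gamma function -/

section ExpGamma

variable {n : ℕ} {μ : Fin n → ℂ} {R : Matrix (Fin n) (Fin n) ℂ}

theorem expGamma_apply (s : ℕ) (a ν : ℂ) (α β : Fin n) :
    expGamma μ R s a ν α β = ∑ k ∈ Finset.range (nilpotencyClass R),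
      ((k.factorial : ℂ))⁻¹ * (degreePart μ s (R ^ k) α β *
        iteratedDeriv k Complex.Gamma (a + μ β + ν)) := by
  simp only [expGamma, Matrix.sum_apply, Matrix.smul_apply, Matrix.mul_diagonal, smul_eq_mul,
    iteratedDeriv_comp_const_add]

/-- This is Γ(x+1) = xΓ(x) at x = a + μ + ν + R, in degree s. Moving μ from the right of R^k to the
left costs s, since the degree-s part maps μ_β to μ_β + s; the R-term comes from the derivative of
the factor x. -/
theorem expGamma_add_one (hR : IsGraded μ R) (hN : IsNilpotent R) (s : ℕ) (a ν : ℂ)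
    (ha : ∀ β, ∀ m : ℕ, a + μ β + ν ≠ -m) :
    expGamma μ R s (a + 1) ν = (a + ν - s) • expGamma μ R s a ν
      + Matrix.diagonal μ * expGamma μ R s a ν
      + ∑ p ∈ Finset.HasAntidiagonal.antidiagonal s,
        degreePart μ p.1 R * expGamma μ R p.2 a ν := by
  have h1 : ∑ p ∈ Finset.HasAntidiagonal.antidiagonal s,
        degreePart μ p.1 R * expGamma μ R p.2 a ν
      = ∑ k ∈ Finset.range (nilpotencyClass R), ((k.factorial : ℂ))⁻¹ •
        (degreePart μ s (R ^ (k + 1)) *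
          Matrix.diagonal fun β => iteratedDeriv k Complex.Gamma (a + μ β + ν)) := by
    simp only [expGamma, iteratedDeriv_comp_const_add, Finset.mul_sum]
    rw [Finset.sum_comm]
    refine Finset.sum_congr rfl fun k _ => ?_
    rw [pow_succ', degreePart_mul hR (hR.pow k), Finset.sum_mul, Finset.smul_sum]
    refine Finset.sum_congr rfl fun p _ => ?_
    rw [Matrix.mul_smul, Matrix.mul_assoc]
  rw [h1]
  ext α β
  -- The terms with k Γ^{(k-1)} match those with R^{k+1} after an index shift; both boundary terms
  -- vanish, one by the factor k = 0, the other by nilpotency.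
  set f : ℕ → ℂ := fun k => ((k.factorial : ℂ))⁻¹ * (k * (degreePart μ s (R ^ k) α β *
    iteratedDeriv (k - 1) Complex.Gamma (a + μ β + ν))) with hf
  have h2 : ∑ k ∈ Finset.range (nilpotencyClass R), f k
      = ∑ k ∈ Finset.range (nilpotencyClass R), f (k + 1) := by
    have := Finset.sum_range_succ f (nilpotencyClass R)
    rw [Finset.sum_range_succ'] at this
    have e0 : f 0 = 0 := by simp [hf]
    have e1 : f (nilpotencyClass R) = 0 := by
      simp [hf, pow_nilpotencyClass hN, degreePart_apply]
    rw [e0, e1, add_zero, add_zero] at this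
    exact this.symm
  simp only [Matrix.add_apply, Matrix.smul_apply, Matrix.sum_apply, Matrix.diagonal_mul,
    Matrix.mul_diagonal, smul_eq_mul, expGamma_apply]
  have h3 : ∀ k, ((k.factorial : ℂ))⁻¹ * (degreePart μ s (R ^ (k + 1)) α β *
        iteratedDeriv k Complex.Gamma (a + μ β + ν)) = f (k + 1) := by
    intro k
    have : (k : ℂ) + 1 ≠ 0 := Nat.cast_add_one_ne_zero k
    simp only [hf, Nat.factorial_succ, Nat.cast_mul, Nat.cast_add_one, Nat.add_sub_cancel]
    field_simp
  rw [Finset.sum_congr rfl fun k _ => h3 k, ← h2, Finset.mul_sum, Finset.mul_sum,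
    ← Finset.sum_add_distrib, ← Finset.sum_add_distrib]
  refine Finset.sum_congr rfl fun k _ => ?_
  rw [show a + 1 + μ β + ν = a + μ β + ν + 1 by ring, iteratedDeriv_Gamma_add_one (ha β)]
  simp only [hf, degreePart_apply]
  split_ifs with h
  · rw [h]; ring
  · simp

end ExpGamma

/-! ## The pairing of the Laplace coefficients -/

section EulerOperator

variable {A : Type*} [Ring A] [Algebra ℂ A]

/-- The operator `z d/dz` on power series. -/
def eulerOp (f : PowerSeries A) : PowerSeries A := PowerSeries.mk fun p => (p : ℂ) • f.coeff p

theorem eulerOp_mul (f g : PowerSeries A) : eulerOp (f * g) = eulerOp f * g + f * eulerOp g := by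
  ext k
  simp only [eulerOp, PowerSeries.coeff_mk, PowerSeries.coeff_mul, map_add, Finset.smul_sum,
    ← Finset.sum_add_distrib]
  refine Finset.sum_congr rfl fun p hp => ?_
  rw [← Finset.HasAntidiagonal.mem_antidiagonal.1 hp, smul_mul_assoc, mul_smul_comm, ← add_smul,
    Nat.cast_add]

end EulerOperator

section Pairing

variable {n : ℕ} {μ : Fin n → ℂ} {R η U : Matrix (Fin n) (Fin n) ℂ}
  {Θ : ℕ → Matrix (Fin n) (Fin n) ℂ}

/-- The coefficients of the Laplace integral of `Θ(z) z^{μ+ν} z^R`, with the argument of the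
Gamma function detached from the summation index. -/
def laplaceCoeff (μ : Fin n → ℂ) (R : Matrix (Fin n) (Fin n) ℂ)
    (Θ : ℕ → Matrix (Fin n) (Fin n) ℂ) (ν c : ℂ) (q : ℕ) : Matrix (Fin n) (Fin n) ℂ :=
  ∑ p ∈ Finset.HasAntidiagonal.antidiagonal q, Θ p.1 * expGamma μ R p.2 (c + 1 / 2) ν

/-- The part of the quasi-homogeneity equation that survives after `∂_E` is eliminated. -/
def IsEulerSystem (μ : Fin n → ℂ) (R U : Matrix (Fin n) (Fin n) ℂ)
    (Θ : ℕ → Matrix (Fin n) (Fin n) ℂ) : Prop :=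
  ∀ p : ℕ, U * Θ p = ((p : ℂ) + 1) • Θ (p + 1) + Θ (p + 1) * Matrix.diagonal μ
    - Matrix.diagonal μ * Θ (p + 1)
    + ∑ x ∈ Finset.HasAntidiagonal.antidiagonal (p + 1), Θ x.1 * degreePart μ x.2 R

/-- The formal counterpart of integrating by parts in z. With A_c(z) the series of coefficients at
fixed c, the equation of Θ and the functional equation of Γ combine to z𝒰A_c = A_{c+1} - (c + 1/2 +
ν)A_c + zA_c' - μA_c; the terms with Θμ and ΘR(z) cancel between the two. -/
theorem laplaceCoeff_recursion (hU : IsEulerSystem μ R U Θ) (h0 : Θ 0 = 1)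
    (hR : IsGraded μ R) (hR0 : degreePart μ 0 R = 0) (hN : IsNilpotent R) (ν c : ℂ)
    (hc : ∀ β, ∀ m : ℕ, c + 1 / 2 + μ β + ν ≠ -m) (q : ℕ) :
    (if q = 0 then 0 else U * laplaceCoeff μ R Θ ν c (q - 1))
      = laplaceCoeff μ R Θ ν (c + 1) q + ((q : ℂ) - c - 1 / 2 - ν) • laplaceCoeff μ R Θ ν c q
        - Matrix.diagonal μ * laplaceCoeff μ R Θ ν c q := by
  set T := PowerSeries.mk Θ with hT
  set E := fun c : ℂ => PowerSeries.mk fun s => expGamma μ R s (c + 1 / 2) ν with hE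
  set r := PowerSeries.mk fun s => degreePart μ s R with hr
  set d := PowerSeries.C (Matrix.diagonal μ) with hd
  have hA : ∀ c, PowerSeries.mk (laplaceCoeff μ R Θ ν c) = T * E c := by
    intro c
    ext1 k
    rw [PowerSeries.coeff_mul]
    simp [hT, hE, laplaceCoeff]
  have h1 : PowerSeries.X * PowerSeries.C U * T = eulerOp T + T * d - d * T + T * r := by
    ext1 k
    -- The Euler system only concerns positive powers of z; at z^0 the equation holds because Θ_0 =
    -- 1 and R has no degree-zero part.
    rcases k with _ | p
    · simp [mul_assoc, hT, eulerOp, h0, hd, hr, hR0, -PowerSeries.coeff_zero_eq_constantCoeff,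
        PowerSeries.coeff_mul]
    · rw [mul_assoc, PowerSeries.coeff_succ_X_mul]
      simp only [map_add, map_sub, hT, hd, hr, eulerOp, PowerSeries.coeff_C_mul,
        PowerSeries.coeff_mul_C, PowerSeries.coeff_mk, hU p]
      simp only [PowerSeries.coeff_mul, PowerSeries.coeff_mk]
      push_cast
      rfl
  have h2 : E (c + 1) = (c + 1 / 2 + ν) • E c - eulerOp (E c) + d * E c + r * E c := by
    ext1 k
    simp only [map_add, map_sub, hE, hd, hr, eulerOp, PowerSeries.coeff_C_mul,
      PowerSeries.coeff_mk, PowerSeries.coeff_smul]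
    simp only [PowerSeries.coeff_mul, PowerSeries.coeff_mk]
    rw [show c + 1 + 1 / 2 = c + 1 / 2 + 1 by ring, expGamma_add_one hR hN k _ _ hc, sub_smul]
  have h3 : PowerSeries.X * PowerSeries.C U * (T * E c)
      = T * E (c + 1) - (c + 1 / 2 + ν) • (T * E c) + eulerOp (T * E c) - d * (T * E c) := by
    rw [← mul_assoc, h1, h2, eulerOp_mul]
    simp only [mul_add, add_mul, mul_sub, sub_mul, mul_smul_comm, mul_assoc]
    abel
  have h4 := congrArg (PowerSeries.coeff q) h3
  rw [← hA, ← hA] at h4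
  have h5 : PowerSeries.coeff q (PowerSeries.X * PowerSeries.C U *
      PowerSeries.mk (laplaceCoeff μ R Θ ν c))
      = if q = 0 then 0 else U * laplaceCoeff μ R Θ ν c (q - 1) := by
    rcases q with _ | q
    · simp [mul_assoc]
    · rw [mul_assoc, PowerSeries.coeff_succ_X_mul]
      simp
  rw [← h5, h4]
  simp only [map_add, map_sub, hd, eulerOp, PowerSeries.coeff_C_mul,
        PowerSeries.coeff_mk, PowerSeries.coeff_smul]
  module

/-- The telescoping sum behind the orthogonality of the periods. -/
theorem telescope {V : Type*} [AddCommGroup V] (k : ℕ) (h y : ℕ → ℕ → V)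
    (hy0 : ∀ j < k, y j 0 = h j 0 + h (j + 1) 0)
    (hy : ∀ j < k, ∀ i < k, i + 1 < k → y j (i + 1) + y j i = h j (i + 1) + h (j + 1) (i + 1)) :
    ∑ j ∈ Finset.range k, y j j - ∑ j ∈ Finset.range (k + 1), h j j
      = -∑ i ∈ Finset.range (k + 1), (-1 : ℤ) ^ (k - i) • h k i := by
  -- The alternating partial sums satisfy Z j (m+1) + Z j m = h j (m+1), so they solve the relation
  -- for y: y j i = Z j i + Z (j+1) i. The diagonal difference then collapses to -Z m m by
  -- induction.
  set Z : ℕ → ℕ → V := fun j m => ∑ i ∈ Finset.range (m + 1), (-1 : ℤ) ^ (m - i) • h j i with hZ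
  have hZs : ∀ j m, Z j (m + 1) = h j (m + 1) - Z j m := by
    intro j m
    simp only [hZ]
    rw [Finset.sum_range_succ, Nat.sub_self, pow_zero, one_smul, sub_eq_add_neg, add_comm,
      ← Finset.sum_neg_distrib]
    congr 1
    refine Finset.sum_congr rfl fun i hi => ?_
    rw [Nat.succ_sub (Nat.lt_succ_iff.1 (Finset.mem_range.1 hi)), pow_succ, mul_neg_one, neg_smul]
  have hyZ : ∀ j < k, ∀ i < k, y j i = Z j i + Z (j + 1) i := by
    intro j hj i
    induction i with
    | zero => intro _; simp [hZ, hy0 j hj]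
    | succ i ih =>
      intro hi
      have := hy j hj i (by omega) hi
      rw [ih (by omega)] at this
      rw [hZs, hZs, eq_sub_of_add_eq this]
      abel
  have hd : ∀ m ≤ k, ∑ j ∈ Finset.range m, y j j - ∑ j ∈ Finset.range (m + 1), h j j = -Z m m := by
    intro m
    induction m with
    | zero => intro _; simp [hZ]
    | succ m ih =>
      intro hm
      have := ih (by omega)
      rw [Finset.sum_range_succ, Finset.sum_range_succ (n := m + 1), hyZ m (by omega) m (by omega),
        hZs]
      rw [show ∀ a b c d e : V, a + (b + c) - (d + e) = (a - d) + b + c - e by intros; abel, this]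
      abel
  exact hd k le_rfl

/-- In the first factor j is the Gamma argument c and i the summation index. The diagonal i = j is
what the periods pair; the telescoping moves c to its extreme values k and 0 while i keeps running.
-/
theorem laplaceCoeff_pairing
    (hU : IsEulerSystem μ R U Θ) (h0 : Θ 0 = 1) (hR : IsGraded μ R)
    (hR0 : degreePart μ 0 R = 0) (hN : IsNilpotent R) (hηU : U.transpose * η = η * U)
    (hημ : Matrix.diagonal μ * η = -(η * Matrix.diagonal μ)) (ν : ℂ)
    (hν : ∀ (α : Fin n) (k : ℤ), μ α + ν + 1 / 2 ≠ k)
    (hν' : ∀ (α : Fin n) (k : ℤ), μ α - ν + 1 / 2 ≠ k) (k : ℕ) :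
    ∑ j ∈ Finset.range k, (laplaceCoeff μ R Θ (-ν) j j).transpose * η * U *
        laplaceCoeff μ R Θ ν (k - 1 - j : ℕ) (k - 1 - j)
      - ∑ j ∈ Finset.range (k + 1), (laplaceCoeff μ R Θ (-ν) j j).transpose * η *
        laplaceCoeff μ R Θ ν (k - j : ℕ) (k - j)
      = -∑ i ∈ Finset.range (k + 1), (-1 : ℤ) ^ (k - i) •
        ((laplaceCoeff μ R Θ (-ν) k i).transpose * η * laplaceCoeff μ R Θ ν 0 (k - i)) := by
  -- A pole -m of the Gamma function at c = j would make μ_β + ν + 1/2 the integer -m - j.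
  have rec1 := fun (j : ℕ) => laplaceCoeff_recursion hU h0 hR hR0 hN ν j (fun β m h =>
    hν β (-m - j) (by push_cast; linear_combination h))
  have rec2 := fun (j : ℕ) => laplaceCoeff_recursion hU h0 hR hR0 hN (-ν) j (fun β m h =>
    hν' β (-m - j) (by push_cast; linear_combination h))
  -- Add the recursions of the two factors. The scalars i' - j' - 1/2 - ν and i - j - 1/2 + ν sum to
  -- zero exactly when j + j' + 1 = i + i', and the μ-terms cancel by skewness.
  have step : ∀ j j' i i' : ℕ, j + j' + 1 = i + i' →
      (laplaceCoeff μ R Θ (-ν) j i).transpose * η *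
          (if i' = 0 then 0 else U * laplaceCoeff μ R Θ ν j' (i' - 1))
        + (if i = 0 then 0 else U * laplaceCoeff μ R Θ (-ν) j (i - 1)).transpose * η *
          laplaceCoeff μ R Θ ν j' i'
      = (laplaceCoeff μ R Θ (-ν) j i).transpose * η * laplaceCoeff μ R Θ ν (j' + 1) i'
        + (laplaceCoeff μ R Θ (-ν) (j + 1) i).transpose * η * laplaceCoeff μ R Θ ν j' i' := by
    intro j j' i i' hji
    have hc : (j : ℂ) + j' + 1 = i + i' := by exact_mod_cast hji
    rw [rec1, rec2]
    set A := laplaceCoeff μ R Θ (-ν) j i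
    set B := laplaceCoeff μ R Θ ν j' i'
    have e : A.transpose * (Matrix.diagonal μ * (η * B))
        = -(A.transpose * (η * (Matrix.diagonal μ * B))) := by
      rw [← Matrix.mul_assoc (Matrix.diagonal μ), hημ, Matrix.neg_mul, Matrix.mul_neg,
        Matrix.mul_assoc]
    have hc' : (i : ℂ) = j + j' + 1 - i' := by rw [hc]; ring
    simp only [Matrix.transpose_sub, Matrix.transpose_add, Matrix.transpose_smul,
      Matrix.transpose_mul, Matrix.diagonal_transpose, Matrix.mul_add, Matrix.mul_sub,
      Matrix.add_mul, Matrix.sub_mul, Matrix.mul_smul, Matrix.smul_mul, Matrix.mul_assoc, e]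
    rw [hc']
    module
  have hUt : ∀ A B : Matrix (Fin n) (Fin n) ℂ,
      (U * A).transpose * η * B = A.transpose * η * U * B := by
    intro A B
    rw [Matrix.transpose_mul, Matrix.mul_assoc A.transpose, hηU]
    simp only [Matrix.mul_assoc]
  have htel := telescope k
    (fun j i => (laplaceCoeff μ R Θ (-ν) j i).transpose * η *
      laplaceCoeff μ R Θ ν (k - j : ℕ) (k - i))
    (fun j i => (laplaceCoeff μ R Θ (-ν) j i).transpose * η * U *
      laplaceCoeff μ R Θ ν (k - 1 - j : ℕ) (k - 1 - i)) ?_ ?_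
  · simpa using htel
  -- At i = 0 the recursion of the first factor has no 𝒰-term, so only one y occurs.
  · intro j hj
    have := step j (k - 1 - j) 0 k (by omega)
    rw [if_neg (by omega), if_pos rfl] at this
    have e : ((k - 1 - j : ℕ) : ℂ) + 1 = ((k - j : ℕ) : ℂ) := by
      rw [← Nat.cast_add_one]; congr 1; omega
    have e' : k - 1 - j = k - (j + 1) := by omega
    rw [e] at this
    simp only [Matrix.transpose_zero, Matrix.zero_mul, add_zero] at this
    simp only [Nat.sub_zero, ← e', Nat.cast_add_one]
    rw [← this]
    simp only [Matrix.mul_assoc]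
  · intro j hj i _ hi
    have := step j (k - 1 - j) (i + 1) (k - (i + 1)) (by omega)
    rw [if_neg (by omega), if_neg (by omega), hUt, Nat.add_sub_cancel] at this
    have e : ((k - 1 - j : ℕ) : ℂ) + 1 = ((k - j : ℕ) : ℂ) := by
      rw [← Nat.cast_add_one]; congr 1; omega
    have e' : k - (j + 1) = k - 1 - j := by omega
    have e1 : k - 1 - (i + 1) = k - (i + 1) - 1 := by omega
    have e2 : k - 1 - i = k - (i + 1) := by omega
    rw [e] at this
    simp only [e', e1, e2, Nat.cast_add_one]
    rw [← this]
    simp only [Matrix.mul_assoc]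

end Pairing

/-! ### Evaluation of the pairing: from Θ to Gamma products -/

section Evaluation

variable {n : ℕ} {μ : Fin n → ℂ} {R η : Matrix (Fin n) (Fin n) ℂ}
  {Θ : ℕ → Matrix (Fin n) (Fin n) ℂ}

/-- For fixed c and c' the alternating sum is a coefficient of a product of power series in z that
contains Θ(-z)ᵀ η Θ(z) = η in the middle. -/
theorem sum_laplaceCoeff_eq_of_orthogonal
    (hΘ : ∀ k : ℕ, ∑ pq ∈ Finset.HasAntidiagonal.antidiagonal k, (-1 : ℂ) ^ pq.1 •
      ((Θ pq.1).transpose * η * Θ pq.2) = if k = 0 then η else 0) (ν ν' c c' : ℂ) (k : ℕ) :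
    ∑ x ∈ Finset.HasAntidiagonal.antidiagonal k, (-1 : ℂ) ^ x.1 •
      ((laplaceCoeff μ R Θ ν c x.1).transpose * η * laplaceCoeff μ R Θ ν' c' x.2)
    = ∑ x ∈ Finset.HasAntidiagonal.antidiagonal k, (-1 : ℂ) ^ x.1 •
      ((expGamma μ R x.1 (c + 1 / 2) ν).transpose * η * expGamma μ R x.2 (c' + 1 / 2) ν') := by
  set T := PowerSeries.mk Θ with hT
  set E := PowerSeries.mk fun s => expGamma μ R s (c' + 1 / 2) ν' with hE
  set T' := PowerSeries.mk fun p => (-1 : ℂ) ^ p • (Θ p).transpose with hT'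
  set E' := PowerSeries.mk fun s => (-1 : ℂ) ^ s • (expGamma μ R s (c + 1 / 2) ν).transpose with hE'
  have h1 : T' * PowerSeries.C η * T = PowerSeries.C η := by
    ext1 k
    rw [PowerSeries.coeff_mul]
    simp only [hT, hT', PowerSeries.coeff_mul_C, PowerSeries.coeff_mk, Matrix.smul_mul, hΘ,
      PowerSeries.coeff_C]
  have h2 : PowerSeries.mk (laplaceCoeff μ R Θ ν' c') = T * E := by
    ext1 k
    rw [PowerSeries.coeff_mul]
    simp [hT, hE, laplaceCoeff]
  have h3 : PowerSeries.mk (fun q => (-1 : ℂ) ^ q • (laplaceCoeff μ R Θ ν c q).transpose)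
      = E' * T' := by
    ext1 k
    rw [PowerSeries.coeff_mul, ← Finset.Nat.sum_antidiagonal_swap]
    simp only [hT', hE', laplaceCoeff, PowerSeries.coeff_mk, Matrix.transpose_sum,
      Finset.smul_sum, Matrix.transpose_mul]
    refine Finset.sum_congr rfl fun p hp => ?_
    rw [← Finset.HasAntidiagonal.mem_antidiagonal.1 hp, Matrix.smul_mul, Matrix.mul_smul, smul_smul,
      Prod.fst_swap, Prod.snd_swap, ← pow_add, add_comm]
  have h4 : E' * T' * PowerSeries.C η * (T * E) = E' * PowerSeries.C η * E := by
    calc E' * T' * PowerSeries.C η * (T * E) = E' * (T' * PowerSeries.C η * T) * E := by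
          simp only [mul_assoc]
      _ = _ := by rw [h1]
  rw [← h2, ← h3] at h4
  have h5 := congrArg (PowerSeries.coeff k) h4
  rw [PowerSeries.coeff_mul, PowerSeries.coeff_mul] at h5
  simpa only [hE, hE', PowerSeries.coeff_mul_C, PowerSeries.coeff_mk, Matrix.smul_mul] using h5

/-- Each of the i factors contributes (-1)^{degree + 1}, and the degrees add up to s. Transposition
reverses the order of the factors, which is why the two sides peel off R at opposite ends. -/
theorem degreePart_pow_transpose_mul (hR : IsGraded μ R)
    (hRη : ∀ s : ℕ, (degreePart μ s R).transpose * η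
      = (-1 : ℂ) ^ (s + 1) • (η * degreePart μ s R)) (i s : ℕ) :
    (degreePart μ s (R ^ i)).transpose * η
      = (-1 : ℂ) ^ (s + i) • (η * degreePart μ s (R ^ i)) := by
  induction i generalizing s with
  | zero =>
    rcases s with _ | s
    · have : degreePart μ 0 (1 : Matrix (Fin n) (Fin n) ℂ) = 1 := by
        ext α β
        by_cases h : α = β <;> simp [degreePart_apply, Matrix.one_apply, h]
      simp [this]
    · have : degreePart μ (s + 1) (1 : Matrix (Fin n) (Fin n) ℂ) = 0 := by
        ext α β
        by_cases h : α = β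
        · have : (s : ℂ) + 1 ≠ 0 := Nat.cast_add_one_ne_zero s
          simp [degreePart_apply, h, this]
        · simp [degreePart_apply, h]
      simp [this]
  | succ i ih =>
    conv_lhs => rw [pow_succ', degreePart_mul hR (hR.pow i), Matrix.transpose_sum, Finset.sum_mul]
    conv_rhs => rw [pow_succ R, degreePart_mul (hR.pow i) hR, ← Finset.Nat.sum_antidiagonal_swap,
      Finset.mul_sum, Finset.smul_sum]
    refine Finset.sum_congr rfl fun p hp => ?_
    rw [Matrix.transpose_mul, Matrix.mul_assoc, hRη, Matrix.mul_smul, ← Matrix.mul_assoc, ih,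
      Matrix.smul_mul, smul_smul, Matrix.mul_assoc, Prod.fst_swap, Prod.snd_swap, ← pow_add,
      ← Finset.HasAntidiagonal.mem_antidiagonal.1 hp]
    congr 2
    ring

/-- The functions `π / cos π(μ_β + ν)`, as products of Gamma functions. -/
def gammaProd (μ : Fin n → ℂ) (β : Fin n) (ν : ℂ) : ℂ :=
  Complex.Gamma (1 / 2 + μ β + ν) * Complex.Gamma (1 / 2 - μ β - ν)

theorem ne_neg_nat_of_add (hν : ∀ (α : Fin n) (k : ℤ), μ α + ν + 1 / 2 ≠ k) (β : Fin n) (m : ℕ) :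
    1 / 2 + μ β + ν ≠ -m := fun h => hν β (-m) (by push_cast; linear_combination h)

theorem ne_neg_nat_of_sub (hν : ∀ (α : Fin n) (k : ℤ), μ α + ν + 1 / 2 ≠ k) (β : Fin n) (m : ℕ) :
    1 / 2 - μ β - ν ≠ -m := fun h => hν β (m + 1) (by push_cast; linear_combination -h)

theorem contDiffAt_gammaProd {ν : ℂ} (hν : ∀ (α : Fin n) (k : ℤ), μ α + ν + 1 / 2 ≠ k)
    (β : Fin n) {k : WithTop ℕ∞} : ContDiffAt ℂ k (gammaProd μ β) ν :=
  ((contDiffAt_Gamma (ne_neg_nat_of_add hν β)).comp ν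
    (f := fun ν => 1 / 2 + μ β + ν) (by fun_prop)).mul
  ((contDiffAt_Gamma (ne_neg_nat_of_sub hν β)).comp ν
    (f := fun ν => 1 / 2 - μ β - ν) (by fun_prop))

theorem iteratedDeriv_gammaProd {ν : ℂ} (hν : ∀ (α : Fin n) (k : ℤ), μ α + ν + 1 / 2 ≠ k)
    (β : Fin n) (l : ℕ) :
    iteratedDeriv l (gammaProd μ β) ν = ∑ i ∈ Finset.range (l + 1), l.choose i *
      ((-1) ^ i * iteratedDeriv i Complex.Gamma (1 / 2 - μ β - ν)) *
      iteratedDeriv (l - i) Complex.Gamma (1 / 2 + μ β + ν) := by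
  have h : gammaProd μ β = fun ν => Complex.Gamma (1 / 2 - μ β - ν) *
      Complex.Gamma (1 / 2 + μ β + ν) := by
    ext ν
    rw [gammaProd, mul_comm]
  rw [h, iteratedDeriv_fun_mul (f := fun ν => Complex.Gamma (1 / 2 - μ β - ν))
    (g := fun ν => Complex.Gamma (1 / 2 + μ β + ν))
    ((contDiffAt_Gamma (ne_neg_nat_of_sub hν β)).comp ν
      (f := fun ν => 1 / 2 - μ β - ν) (by fun_prop))
    ((contDiffAt_Gamma (ne_neg_nat_of_add hν β)).comp ν
      (f := fun ν => 1 / 2 + μ β + ν) (by fun_prop))]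
  simp only [iteratedDeriv_comp_const_sub, iteratedDeriv_comp_const_add, smul_eq_mul]

/-- Moving Rᵀ through η replaces R^i by (-1)^i R^i once the alternating sign has absorbed the
degree; this is the chain-rule sign of Γ(1/2 - μ - ν). Nonzero entries have μ_α = -μ_δ = -(μ_β + k),
so the choice c = k turns k + 1/2 + μ_α - ν into 1/2 - μ_β - ν, and the Leibniz rule assembles the
product of the two Gamma functions. -/
theorem sum_expGamma_pairing (hR : IsGraded μ R) (hN : IsNilpotent R)
    (hRη : ∀ s : ℕ, (degreePart μ s R).transpose * η
      = (-1 : ℂ) ^ (s + 1) • (η * degreePart μ s R))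
    (hημ : Matrix.diagonal μ * η = -(η * Matrix.diagonal μ)) (ν : ℂ)
    (hν : ∀ (α : Fin n) (k : ℤ), μ α + ν + 1 / 2 ≠ k) (k : ℕ) :
    ∑ x ∈ Finset.HasAntidiagonal.antidiagonal k, (-1 : ℂ) ^ x.1 •
      ((expGamma μ R x.1 (k + 1 / 2) (-ν)).transpose * η * expGamma μ R x.2 (0 + 1 / 2) ν)
    = η * degreePart μ k (nilTaylor R (gammaProd μ) ν) := by
  set N := nilpotencyClass R with hNdef
  set g : ℕ → Fin n → ℂ := fun i α => iteratedDeriv i Complex.Gamma (k + 1 / 2 + μ α + -ν) with hg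
  set g' : ℕ → Fin n → ℂ := fun i β => iteratedDeriv i Complex.Gamma (0 + 1 / 2 + μ β + ν) with hg'
  have h1 : ∀ s : ℕ, (-1 : ℂ) ^ s • ((expGamma μ R s (k + 1 / 2) (-ν)).transpose * η)
      = ∑ i ∈ Finset.range N, (((i.factorial : ℂ))⁻¹ * (-1) ^ i) •
        (Matrix.diagonal (g i) * (η * degreePart μ s (R ^ i))) := by
    intro s
    simp only [expGamma, iteratedDeriv_comp_const_add, Matrix.transpose_sum, Finset.sum_mul,
      Finset.smul_sum, Matrix.transpose_smul, Matrix.transpose_mul, Matrix.diagonal_transpose,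
      Matrix.smul_mul, Matrix.mul_assoc, degreePart_pow_transpose_mul hR hRη, Matrix.mul_smul,
      smul_smul]
    refine Finset.sum_congr rfl fun i _ => ?_
    congr 1
    rw [pow_add]
    have : ((-1 : ℂ) ^ s) * (-1) ^ s = 1 := by rw [← mul_pow]; simp
    linear_combination ((i.factorial : ℂ))⁻¹ * (-1) ^ i * this
  have h2 : ∑ x ∈ Finset.HasAntidiagonal.antidiagonal k, (-1 : ℂ) ^ x.1 •
      ((expGamma μ R x.1 (k + 1 / 2) (-ν)).transpose * η * expGamma μ R x.2 (0 + 1 / 2) ν)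
      = ∑ i ∈ Finset.range N, ∑ j ∈ Finset.range N,
        (((i.factorial : ℂ))⁻¹ * ((j.factorial : ℂ))⁻¹ * (-1) ^ i) •
        (Matrix.diagonal (g i) * (η * degreePart μ k (R ^ (i + j))) * Matrix.diagonal (g' j)) := by
    simp only [← Matrix.smul_mul, h1]
    simp only [expGamma, iteratedDeriv_comp_const_add, Finset.sum_mul, Finset.mul_sum, ← hNdef]
    rw [Finset.sum_comm]
    conv_rhs => rw [Finset.sum_comm]
    refine Finset.sum_congr rfl fun j _ => ?_
    rw [Finset.sum_comm]
    refine Finset.sum_congr rfl fun i _ => ?_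
    rw [pow_add, degreePart_mul (hR.pow i) (hR.pow j)]
    simp only [Finset.mul_sum, Finset.sum_mul]
    refine Finset.sum_congr rfl fun x _ => ?_
    simp only [Matrix.smul_mul, Matrix.mul_smul, smul_smul, Matrix.mul_assoc]
    congr 1
    ring
  rw [h2]
  ext α β
  simp only [Matrix.sum_apply, Matrix.smul_apply, Matrix.mul_diagonal, Matrix.diagonal_mul,
    smul_eq_mul, Matrix.mul_apply (M := η), degreePart_apply, Finset.mul_sum, Finset.sum_mul]
  rw [Finset.sum_congr rfl fun i _ => Finset.sum_comm, Finset.sum_comm]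
  refine Finset.sum_congr rfl fun δ _ => ?_
  by_cases hd : μ δ = μ β + k
  swap
  · simp [hd]
  by_cases he : η α δ = 0
  · simp [he]
  have hα : μ α = -μ δ := by
    have h := congrFun (congrFun hημ α) δ
    simp only [Matrix.diagonal_mul, Matrix.mul_diagonal, Matrix.neg_apply] at h
    exact mul_right_cancel₀ he (by linear_combination h)
  simp only [if_pos hd]
  rw [nilTaylor_apply]
  simp only [iteratedDeriv_gammaProd hν]
  rw [← sum_sum_pow_of_nilpotent hN (fun i => (-1) ^ i *
      iteratedDeriv i Complex.Gamma (1 / 2 - μ β - ν))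
      (fun j => iteratedDeriv j Complex.Gamma (1 / 2 + μ β + ν)), Finset.mul_sum]
  refine Finset.sum_congr rfl fun i _ => ?_
  rw [Finset.mul_sum]
  refine Finset.sum_congr rfl fun j _ => ?_
  have e1 : (k : ℂ) + 1 / 2 + μ α + -ν = 1 / 2 - μ β - ν := by rw [hα, hd]; ring
  simp only [hg, hg', e1, zero_add]
  ring

/-- The pairing of the Laplace coefficients of total degree `k`. -/
theorem laplaceCoeff_pairing_eq {U : Matrix (Fin n) (Fin n) ℂ}
    (hU : IsEulerSystem μ R U Θ) (h0 : Θ 0 = 1) (hR : IsGraded μ R)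
    (hR0 : degreePart μ 0 R = 0) (hN : IsNilpotent R) (hηU : U.transpose * η = η * U)
    (hημ : Matrix.diagonal μ * η = -(η * Matrix.diagonal μ))
    (hΘ : ∀ k : ℕ, ∑ pq ∈ Finset.HasAntidiagonal.antidiagonal k, (-1 : ℂ) ^ pq.1 •
      ((Θ pq.1).transpose * η * Θ pq.2) = if k = 0 then η else 0)
    (hRη : ∀ s : ℕ, (degreePart μ s R).transpose * η
      = (-1 : ℂ) ^ (s + 1) • (η * degreePart μ s R)) (ν : ℂ)
    (hν : ∀ (α : Fin n) (k : ℤ), μ α + ν + 1 / 2 ≠ k)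
    (hν' : ∀ (α : Fin n) (k : ℤ), μ α - ν + 1 / 2 ≠ k) (k : ℕ) :
    ∑ j ∈ Finset.range k, (laplaceCoeff μ R Θ (-ν) j j).transpose * η * U *
        laplaceCoeff μ R Θ ν (k - 1 - j : ℕ) (k - 1 - j)
      - ∑ j ∈ Finset.range (k + 1), (laplaceCoeff μ R Θ (-ν) j j).transpose * η *
        laplaceCoeff μ R Θ ν (k - j : ℕ) (k - j)
      = -(-1 : ℂ) ^ k • (η * degreePart μ k (nilTaylor R (gammaProd μ) ν)) := by
  rw [laplaceCoeff_pairing hU h0 hR hR0 hN hηU hημ ν hν hν',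
    ← sum_expGamma_pairing hR hN hRη hημ ν hν, ← sum_laplaceCoeff_eq_of_orthogonal hΘ,
    Finset.Nat.sum_antidiagonal_eq_sum_range_succ_mk, neg_smul, Finset.smul_sum]
  congr 1
  refine Finset.sum_congr rfl fun i hi => ?_
  have hi' : i ≤ k := Nat.lt_succ_iff.1 (Finset.mem_range.1 hi)
  obtain ⟨j, rfl⟩ := Nat.exists_eq_add_of_le hi'
  rw [Nat.add_sub_cancel_left, smul_smul, ← pow_add, show i + j + i = j + 2 * i by ring, pow_add,
    pow_mul]
  rcases Nat.even_or_odd j with h | h <;> simp [h.neg_one_pow]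

end Evaluation

/-! ## The inverse of the Gram matrix -/

section GramInverse

variable {n : ℕ} {μ : Fin n → ℂ} {R η : Matrix (Fin n) (Fin n) ℂ}

theorem exp_eq_sum_of_nilpotent (hN : IsNilpotent R) (c : ℂ) :
    NormedSpace.exp (c • R)
      = ∑ i ∈ Finset.range (nilpotencyClass R), ((i.factorial : ℂ))⁻¹ • c ^ i • R ^ i := by
  rw [NormedSpace.exp_eq_tsum ℂ]
  simp only [smul_pow]
  refine tsum_eq_sum fun i hi => ?_
  rw [pow_eq_zero_of_le (not_lt.1 fun h => hi (Finset.mem_range.2 h)) (pow_nilpotencyClass hN),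
    smul_zero, smul_zero]

/-- `e^{c μ}`. -/
def expDiag (μ : Fin n → ℂ) (c : ℂ) : Matrix (Fin n) (Fin n) ℂ :=
  Matrix.diagonal fun β => Complex.exp (c * μ β)

/-- Multiplicativity of the Taylor expansion in R against e^{c(μ+ν)}: since e^{cR} contains only
powers of R, no commutation with μ is needed. -/
theorem exp_mul_nilTaylor (hN : IsNilpotent R) (c ν : ℂ) (f : Fin n → ℂ → ℂ)
    (hf : ∀ β, ∀ l : ℕ, ContDiffAt ℂ l (f β) ν) :
    NormedSpace.exp (c • R) * nilTaylor R f ν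
        * Matrix.diagonal (fun β => Complex.exp (c * (μ β + ν)))
      = nilTaylor R (fun β ν' => Complex.exp (c * (μ β + ν')) * f β ν') ν := by
  have hexp : ∀ β : Fin n, ∀ i : ℕ, iteratedDeriv i (fun ν' => Complex.exp (c * (μ β + ν'))) ν
      = c ^ i * Complex.exp (c * (μ β + ν)) := by
    intro β i
    rw [iteratedDeriv_comp_const_add i (fun z => Complex.exp (c * z)) (μ β),
      iteratedDeriv_cexp_const_mul]
  have hder : ∀ β : Fin n, ∀ l : ℕ,
      iteratedDeriv l (fun ν' => Complex.exp (c * (μ β + ν')) * f β ν') ν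
      = ∑ i ∈ Finset.range (l + 1), l.choose i * (c ^ i * Complex.exp (c * (μ β + ν)))
        * iteratedDeriv (l - i) (f β) ν := by
    intro β l
    rw [iteratedDeriv_fun_mul (f := fun ν' => Complex.exp (c * (μ β + ν'))) (by fun_prop) (hf β l)]
    simp only [hexp]
  ext α β
  rw [nilTaylor_apply]
  simp only [hder]
  rw [← sum_sum_pow_of_nilpotent hN (fun i => c ^ i * Complex.exp (c * (μ β + ν)))
    (fun j => iteratedDeriv j (f β) ν), exp_eq_sum_of_nilpotent hN, nilTaylor]
  simp only [Matrix.mul_diagonal, Finset.sum_mul, Finset.mul_sum, Matrix.sum_apply]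
  rw [Finset.sum_comm]
  refine Finset.sum_congr rfl fun i _ => Finset.sum_congr rfl fun j _ => ?_
  simp only [Matrix.smul_mul, Matrix.mul_smul, Matrix.smul_apply, ← Matrix.mul_assoc, ← pow_add,
    Matrix.mul_diagonal, smul_eq_mul]
  ring

theorem nilTaylor_add (ν : ℂ) (f g : Fin n → ℂ → ℂ)
    (hf : ∀ β, ∀ l : ℕ, ContDiffAt ℂ l (f β) ν) (hg : ∀ β, ∀ l : ℕ, ContDiffAt ℂ l (g β) ν) :
    nilTaylor R f ν + nilTaylor R g ν = nilTaylor R (fun β ν' => f β ν' + g β ν') ν := by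
  ext α β
  rw [Matrix.add_apply]
  simp only [nilTaylor_apply, ← Finset.sum_add_distrib]
  refine Finset.sum_congr rfl fun k _ => ?_
  rw [iteratedDeriv_fun_add (hf β k) (hg β k)]
  ring

theorem nilTaylor_eq_smul_one (hN : IsNilpotent R) (ν a : ℂ) (f : Fin n → ℂ → ℂ)
    (hf : ∀ β, f β =ᶠ[nhds ν] fun _ => a) : nilTaylor R f ν = a • 1 := by
  ext α β
  rw [nilTaylor_apply]
  simp only [(hf β).iteratedDeriv_eq, iteratedDeriv_const]
  -- Nilpotency class zero means 1 = 0, so both sides vanish; otherwise only the k = 0 term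
  -- survives.
  rcases h : nilpotencyClass R with _ | N
  · have h1 := pow_nilpotencyClass hN
    rw [h, pow_zero] at h1
    simp [h1]
  · rw [Finset.sum_range_succ']
    simp [mul_comm]

/-- Euler's reflection formula gives π/cos π(μ_β + ν), and the exponentials sum to twice the cosine,
nonzero by the hypothesis on ν. -/
theorem exp_add_exp_mul_gammaProd (β : Fin n) {ν : ℂ}
    (hν : ∀ k : ℤ, μ β + ν + 1 / 2 ≠ k) :
    Complex.exp (Real.pi * Complex.I * (μ β + ν)) * gammaProd μ β ν
      + Complex.exp (-(Real.pi * Complex.I) * (μ β + ν)) * gammaProd μ β ν = 2 * Real.pi := by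
  have h := Complex.Gamma_mul_Gamma_one_sub (1 / 2 + μ β + ν)
  rw [show 1 - (1 / 2 + μ β + ν) = 1 / 2 - μ β - ν by ring] at h
  rw [gammaProd, h, ← add_mul,
    show (Real.pi : ℂ) * (1 / 2 + μ β + ν) = Real.pi * (μ β + ν) + Real.pi / 2 by ring,
    Complex.sin_add_pi_div_two]
  have hc : Complex.cos (Real.pi * (μ β + ν)) ≠ 0 := by
    rw [Ne, Complex.cos_eq_zero_iff]
    rintro ⟨k, hk⟩
    have hpi : (Real.pi : ℂ) ≠ 0 := by exact_mod_cast Real.pi_ne_zero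
    refine hν (k + 1) ?_
    have : μ β + ν = (2 * k + 1) / 2 := mul_left_cancel₀ hpi (by rw [hk]; ring)
    rw [this]
    push_cast
    ring
  have h2 := Complex.two_cos (Real.pi * (μ β + ν))
  rw [show Real.pi * Complex.I * (μ β + ν) = Real.pi * (μ β + ν) * Complex.I by ring,
    show -(Real.pi * Complex.I) * (μ β + ν) = -(Real.pi * (μ β + ν)) * Complex.I by ring, ← h2]
  field_simp

/-- Degrees are integers, so e^{2πiμ} commutes with A. With the opposite sign, in
`expDiag_neg_conj`, the exponentials cancel outright and gradedness is not needed. -/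
theorem expDiag_conj {A : Matrix (Fin n) (Fin n) ℂ} (hA : IsGraded μ A) (ν : ℂ) :
    Matrix.diagonal (fun β => Complex.exp (Real.pi * Complex.I * (μ β + ν)))
        * (expDiag μ (Real.pi * Complex.I) * A * expDiag μ (-(Real.pi * Complex.I)))
      = A * Matrix.diagonal (fun β => Complex.exp (Real.pi * Complex.I * (μ β + ν))) := by
  ext α β
  simp only [expDiag, Matrix.mul_diagonal, Matrix.diagonal_mul]
  by_cases h : A α β = 0
  · simp [h]
  obtain ⟨s, hs⟩ := hA α β h
  rw [hs]
  have h1 : Complex.exp (Real.pi * Complex.I * (μ β + s + ν)) *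
      (Complex.exp (Real.pi * Complex.I * (μ β + s)) * Complex.exp (-(Real.pi * Complex.I) * μ β))
      = Complex.exp (Real.pi * Complex.I * (μ β + ν)) := by
    rw [← Complex.exp_add, ← Complex.exp_add, Complex.exp_eq_exp_iff_exists_int]
    exact ⟨s, by push_cast; ring⟩
  linear_combination A α β * h1

theorem expDiag_neg_conj {A : Matrix (Fin n) (Fin n) ℂ} (ν : ℂ) :
    Matrix.diagonal (fun β => Complex.exp (-(Real.pi * Complex.I) * (μ β + ν)))
        * (expDiag μ (Real.pi * Complex.I) * A * expDiag μ (-(Real.pi * Complex.I)))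
      = A * Matrix.diagonal (fun β => Complex.exp (-(Real.pi * Complex.I) * (μ β + ν))) := by
  ext α β
  simp only [expDiag, Matrix.mul_diagonal, Matrix.diagonal_mul]
  have h1 : Complex.exp (-(Real.pi * Complex.I) * (μ α + ν)) *
      (Complex.exp (Real.pi * Complex.I * μ α) * Complex.exp (-(Real.pi * Complex.I) * μ β))
      = Complex.exp (-(Real.pi * Complex.I) * (μ β + ν)) := by
    rw [← Complex.exp_add, ← Complex.exp_add]
    congr 1
    ring
  linear_combination A α β * h1

theorem exp_smul_diagonal (c ν : ℂ) :
    NormedSpace.exp (c • (Matrix.diagonal μ + ν • (1 : Matrix (Fin n) (Fin n) ℂ)))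
      = Matrix.diagonal fun β => Complex.exp (c * (μ β + ν)) := by
  have : c • (Matrix.diagonal μ + ν • (1 : Matrix (Fin n) (Fin n) ℂ))
      = Matrix.diagonal fun β => c * (μ β + ν) := by
    ext α β
    by_cases h : α = β <;> simp [h]
  rw [this, Matrix.exp_diagonal, Pi.exp_def]
  simp only [Complex.exp_eq_exp_ℂ]

/-- The inverse of `G(ν)`. -/
def gramInv (μ : Fin n → ℂ) (R η : Matrix (Fin n) (Fin n) ℂ) (ν : ℂ) :
    Matrix (Fin n) (Fin n) ℂ :=
  -(η * (expDiag μ (Real.pi * Complex.I) * nilTaylor R (gammaProd μ) ν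
    * expDiag μ (-(Real.pi * Complex.I))))

theorem eventually_add_ne {ν : ℂ} (hν : ∀ (α : Fin n) (k : ℤ), μ α + ν + 1 / 2 ≠ k) (β : Fin n) :
    ∀ᶠ ν' in nhds ν, ∀ k : ℤ, μ β + ν' + 1 / 2 ≠ k := by
  have ho : IsOpen (Set.range ((↑) : ℤ → ℂ))ᶜ :=
    Complex.isClosedEmbedding_intCast.isClosed_range.isOpen_compl
  have hc : Continuous fun ν' : ℂ => μ β + ν' + 1 / 2 := by fun_prop
  have hm : ν ∈ (fun ν' : ℂ => μ β + ν' + 1 / 2) ⁻¹' (Set.range ((↑) : ℤ → ℂ))ᶜ := by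
    rintro ⟨k, hk⟩
    exact hν β k hk.symm
  filter_upwards [(ho.preimage hc).mem_nhds hm] with ν' h k hk
  exact h ⟨k, hk.symm⟩

/-- The conjugation in `gramInv` lets both e^{±πi(μ+ν)} pass to the right of the expansion of π/cos.
The product becomes 1/(2π) times the expansion of (e^{πi(μ+ν)} + e^{-πi(μ+ν)}) π/cos π(μ+ν), a
function locally equal to 2π. -/
theorem gramMatrix_mul_gramInv (hR : IsGraded μ R) (hN : IsNilpotent R) (hη : IsUnit η.det) (ν : ℂ)
    (hν : ∀ (α : Fin n) (k : ℤ), μ α + ν + 1 / 2 ≠ k) :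
    gramMatrix μ R η ν * gramInv μ R η ν = 1 := by
  have hpi : (Real.pi : ℂ) ≠ 0 := by exact_mod_cast Real.pi_ne_zero
  have hsm : ∀ c : ℂ, ∀ β, ∀ l : ℕ, ContDiffAt ℂ l
      (fun ν' => Complex.exp (c * (μ β + ν')) * gammaProd μ β ν') ν := fun c β l =>
    ContDiffAt.mul (f := fun ν' => Complex.exp (c * (μ β + ν'))) (by fun_prop)
      (contDiffAt_gammaProd hν β)
  have key : NormedSpace.exp ((Real.pi * Complex.I) • R) * nilTaylor R (gammaProd μ) ν
        * Matrix.diagonal (fun β => Complex.exp (Real.pi * Complex.I * (μ β + ν)))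
      + NormedSpace.exp (-(Real.pi * Complex.I) • R) * nilTaylor R (gammaProd μ) ν
        * Matrix.diagonal (fun β => Complex.exp (-(Real.pi * Complex.I) * (μ β + ν)))
      = (2 * Real.pi : ℂ) • 1 := by
    rw [exp_mul_nilTaylor hN _ _ _ fun β l => contDiffAt_gammaProd hν β,
      exp_mul_nilTaylor hN _ _ _ fun β l => contDiffAt_gammaProd hν β,
      nilTaylor_add _ _ _ (hsm _) (hsm _)]
    refine nilTaylor_eq_smul_one hN _ _ _ fun β => ?_
    filter_upwards [eventually_add_ne hν β] with ν' h
    exact exp_add_exp_mul_gammaProd β h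
  rw [gramMatrix, gramInv, exp_smul_diagonal, exp_smul_diagonal, Matrix.smul_mul, Matrix.mul_assoc,
    Matrix.mul_neg, ← Matrix.mul_assoc η⁻¹, Matrix.nonsing_inv_mul _ hη, Matrix.one_mul,
    Matrix.mul_neg, Matrix.add_mul, Matrix.mul_assoc, expDiag_conj (hR.nilTaylor _ _),
    Matrix.mul_assoc, expDiag_neg_conj, ← Matrix.mul_assoc, ← Matrix.mul_assoc, key, smul_neg,
    smul_smul, neg_mul, neg_smul, neg_neg]
  rw [show 1 / (2 * (Real.pi : ℂ)) * (2 * Real.pi) = 1 by field_simp, one_smul]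

/-- Passing Rᵀ through η⁻¹ yields -e^{πiμ} R e^{-πiμ}; passing it through e^{±πi(μ+ν)} restores R,
which commutes with e^{±πiR}. This skewness is what lets the factors λ^{-R} cancel. -/
theorem gramMatrix_mul_transpose (hR : IsGraded μ R) (hη : IsUnit η.det) (ν : ℂ)
    (hRη : R.transpose * η = -(η * (expDiag μ (Real.pi * Complex.I) * R
      * expDiag μ (-(Real.pi * Complex.I))))) :
    gramMatrix μ R η ν * R.transpose = -(R * gramMatrix μ R η ν) := by
  have h1 : η⁻¹ * R.transpose = -(expDiag μ (Real.pi * Complex.I) * R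
      * expDiag μ (-(Real.pi * Complex.I)) * η⁻¹) := by
    have h2 : η⁻¹ * (R.transpose * η) * η⁻¹ = η⁻¹ * R.transpose := by
      rw [Matrix.mul_assoc, Matrix.mul_assoc, Matrix.mul_nonsing_inv _ hη, Matrix.mul_one]
    rw [← h2, hRη, Matrix.mul_neg, ← Matrix.mul_assoc η⁻¹, Matrix.nonsing_inv_mul _ hη,
      Matrix.one_mul, Matrix.neg_mul]
  have hc : ∀ c : ℂ, NormedSpace.exp (c • R) * R = R * NormedSpace.exp (c • R) := fun c =>
    (((Commute.refl R).smul_left c).exp_left).eq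
  rw [gramMatrix, exp_smul_diagonal, exp_smul_diagonal, Matrix.smul_mul, Matrix.mul_assoc, h1,
    Matrix.mul_neg, ← Matrix.mul_assoc, Matrix.add_mul, Matrix.mul_assoc, expDiag_conj hR,
    Matrix.mul_assoc, expDiag_neg_conj, ← Matrix.mul_assoc, ← Matrix.mul_assoc, hc, hc,
    Matrix.mul_smul, smul_neg]
  simp only [Matrix.mul_add, Matrix.add_mul, Matrix.mul_assoc]

theorem eq_neg_of_skew (hη : Matrix.diagonal μ * η = -(η * Matrix.diagonal μ)) {α δ : Fin n}
    (h : η α δ ≠ 0) : μ α = -μ δ := by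
  have h1 := congrFun (congrFun hη α) δ
  simp only [Matrix.diagonal_mul, Matrix.mul_diagonal, Matrix.neg_apply] at h1
  exact mul_right_cancel₀ h (by linear_combination h1)

theorem exp_pi_I_mul_conj {a b : ℂ} {k : ℕ} (h : a = b + k) :
    Complex.exp (Real.pi * Complex.I * a) * Complex.exp (-(Real.pi * Complex.I) * b)
      = (-1) ^ k := by
  rw [← Complex.exp_add, h, ← Complex.exp_pi_mul_I, ← Complex.exp_nat_mul]
  congr 1
  ring

theorem gramInv_apply_eq (ν : ℂ) (α β : Fin n) :
    gramInv μ R η ν α β = -∑ δ, η α δ * (nilTaylor R (gammaProd μ) ν δ β *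
      (Complex.exp (Real.pi * Complex.I * μ δ) * Complex.exp (-(Real.pi * Complex.I) * μ β))) := by
  rw [gramInv, Matrix.neg_apply, Matrix.mul_apply]
  congr 1
  refine Finset.sum_congr rfl fun δ _ => ?_
  simp only [expDiag, Matrix.mul_diagonal, Matrix.diagonal_mul]
  ring

/-- Conjugation by e^{πiμ} multiplies the degree-k part by (-1)^k. As η pairs μ_δ with -μ_δ, the
degree of the entry (α, β) is -μ_α - μ_β, so different degrees occupy different entries of the
matrix. -/
theorem gramInv_apply (hη : Matrix.diagonal μ * η = -(η * Matrix.diagonal μ)) (ν : ℂ) (k : ℕ)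
    (α β : Fin n) :
    (-(-1 : ℂ) ^ k • (η * degreePart μ k (nilTaylor R (gammaProd μ) ν))) α β
      = if μ α + μ β + k = 0 then gramInv μ R η ν α β else 0 := by
  have h : (-(-1 : ℂ) ^ k • (η * degreePart μ k (nilTaylor R (gammaProd μ) ν))) α β
      = -∑ δ, if μ α + μ β + k = 0 then η α δ * (nilTaylor R (gammaProd μ) ν δ β *
      (Complex.exp (Real.pi * Complex.I * μ δ) * Complex.exp (-(Real.pi * Complex.I) * μ β)))
      else 0 := by
    rw [Matrix.smul_apply, Matrix.mul_apply, smul_eq_mul, neg_mul, Finset.mul_sum]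
    congr 1
    refine Finset.sum_congr rfl fun δ _ => ?_
    by_cases he : η α δ = 0
    · simp [he]
    have hα := eq_neg_of_skew hη he
    have hiff : μ α + μ β + k = 0 ↔ μ δ = μ β + k := by
      rw [hα]
      constructor <;> intro h <;> linear_combination -h
    simp only [hiff, degreePart_apply]
    split_ifs with hd
    · rw [exp_pi_I_mul_conj hd]
      ring
    · simp
  rw [h, gramInv_apply_eq]
  split_ifs <;> simp

theorem gramInv_apply_eq_zero (hη : Matrix.diagonal μ * η = -(η * Matrix.diagonal μ))
    (hR : IsGraded μ R) (ν : ℂ) {α β : Fin n} (h : ∀ k : ℕ, μ α + μ β + k ≠ 0) :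
    gramInv μ R η ν α β = 0 := by
  rw [gramInv_apply_eq, neg_eq_zero]
  refine Finset.sum_eq_zero fun δ _ => ?_
  by_contra hne
  have he := left_ne_zero_of_mul hne
  have hQ := left_ne_zero_of_mul (right_ne_zero_of_mul hne)
  obtain ⟨s, hs⟩ := hR.nilTaylor _ _ δ β hQ
  exact h s (by rw [eq_neg_of_skew hη he, hs]; ring)

end GramInverse

/-! ## Assembling the formal series -/

section Assembly

variable {n : ℕ} {μ : Fin n → ℂ} {R η U : Matrix (Fin n) (Fin n) ℂ}
  {Θ : ℕ → Matrix (Fin n) (Fin n) ℂ}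

/-- R is skew for the form C, so the transpose of e^{-R log λ} moves through C as e^{R log λ} and
cancels the right factor. -/
theorem lamPowNegR_isometry {C : Matrix (Fin n) (Fin n) ℂ} (hN : IsNilpotent R)
    (hC : R.transpose * C = -(C * R)) :
    (lamPowNegR R).transpose * C.map Polynomial.C * lamPowNegR R = C.map Polynomial.C := by
  set Y : Matrix (Fin n) (Fin n) ℂ[X] := (Polynomial.X : ℂ[X]) • R.map Polynomial.C with hY
  set K := C.map (Polynomial.C : ℂ →+* ℂ[X]) with hK
  obtain ⟨N, hRN⟩ := hN
  have hYN : Y ^ N = 0 := by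
    have : (R.map (Polynomial.C : ℂ →+* ℂ[X])) ^ N = 0 := by
      have := congrArg (Polynomial.C : ℂ →+* ℂ[X]).mapMatrix hRN
      rwa [map_pow, map_zero] at this
    rw [hY, smul_pow, this, smul_zero]
  have hYK : (-Y).transpose * K = K * Y := by
    have := congrArg (Polynomial.C : ℂ →+* ℂ[X]).mapMatrix hC
    rw [map_mul, map_neg, map_mul] at this
    simp only [RingHom.mapMatrix_apply, Matrix.transpose_map] at this
    rw [hY, Matrix.transpose_neg, Matrix.transpose_smul, Matrix.neg_mul, Matrix.smul_mul, this,
      Matrix.mul_smul, smul_neg, neg_neg]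
  have hpow : ∀ i : ℕ, ((-Y) ^ i).transpose * K = K * Y ^ i := by
    intro i
    induction i with
    | zero => simp
    | succ i ih =>
      rw [pow_succ, Matrix.transpose_mul, Matrix.mul_assoc, ih, ← Matrix.mul_assoc, hYK, pow_succ',
        Matrix.mul_assoc]
  have hYN' : (-Y) ^ N = 0 := by rw [neg_pow, hYN, mul_zero]
  have hexp : (lamPowNegR R).transpose * K = K * IsNilpotent.exp Y := by
    rw [lamPowNegR, ← hY, IsNilpotent.exp_eq_sum hYN', IsNilpotent.exp_eq_sum hYN,
      Matrix.transpose_sum, Finset.sum_mul, Finset.mul_sum]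
    refine Finset.sum_congr rfl fun i _ => ?_
    rw [Matrix.transpose_smul, Matrix.smul_mul, hpow, Matrix.mul_smul]
  rw [hexp, lamPowNegR, ← hY, Matrix.mul_assoc, IsNilpotent.exp_mul_exp_neg_self ⟨N, hYN⟩,
    Matrix.mul_one]

/-- The power series in `λ^{-1}` that precedes `λ^{-(μ+ν+1/2)} λ^{-R}` in the Laplace integral. -/
def laplaceSeries (μ : Fin n → ℂ) (R : Matrix (Fin n) (Fin n) ℂ)
    (Θ : ℕ → Matrix (Fin n) (Fin n) ℂ) (ν : ℂ) : Matrix (Fin n) (Fin n) (PowerSeries ℂ[X]) :=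
  Matrix.of fun γ β => PowerSeries.mk fun q => Polynomial.C (laplaceCoeff μ R Θ ν q q γ β)

/-- `λ^{-(μ+ν+1/2)}`. -/
def lamPowDiag (μ : Fin n → ℂ) (ν : ℂ) : Matrix (Fin n) (Fin n) LambdaSeries :=
  Matrix.diagonal fun β => HahnSeries.single (μ β + ν + 1 / 2) (1 : ℂ[X])

theorem formalLaplace_eq (ν : ℂ) :
    (Matrix.of fun γ => formalLaplace μ R (fun p α => Θ p γ α) ν)
      = (laplaceSeries μ R Θ ν).map (HahnSeries.ofPowerSeries ℂ ℂ[X])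
        * lamPowDiag μ ν * (lamPowNegR R).map HahnSeries.C := by
  ext1 γ β
  rw [Matrix.mul_assoc, Matrix.mul_apply]
  simp only [formalLaplace, Matrix.of_apply, Matrix.vecMul, dotProduct, lamPowDiag, Matrix.map_apply,
    laplaceSeries, laplaceCoeff, Matrix.sum_apply, Matrix.mul_apply, Finset.sum_apply]

theorem coeff_mul_const_mul (A B : ℕ → Matrix (Fin n) (Fin n) ℂ) (K : Matrix (Fin n) (Fin n) ℂ)
    (k : ℕ) (α β : Fin n) :
    (((Matrix.of fun γ δ => PowerSeries.mk fun q => (Polynomial.C (A q γ δ) : ℂ[X])).transpose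
      * K.map (fun a => PowerSeries.C (Polynomial.C a))
      * (Matrix.of fun γ δ => PowerSeries.mk fun q => (Polynomial.C (B q γ δ) : ℂ[X]))) α β).coeff k
    = Polynomial.C ((∑ j ∈ Finset.range (k + 1),
        (A j).transpose * K * B (k - j)) α β) := by
  have h : ∀ (a b : ℕ → ℂ) (κ : ℂ), (PowerSeries.mk (fun q => (Polynomial.C (a q) : ℂ[X]))
      * PowerSeries.C (Polynomial.C κ) * PowerSeries.mk fun q => Polynomial.C (b q)).coeff k
      = Polynomial.C (∑ j ∈ Finset.range (k + 1), a j * κ * b (k - j)) := by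
    intro a b κ
    rw [PowerSeries.coeff_mul, Finset.Nat.sum_antidiagonal_eq_sum_range_succ_mk]
    simp only [PowerSeries.coeff_mul_C, PowerSeries.coeff_mk, map_sum, map_mul]
  simp only [Matrix.mul_apply, Matrix.sum_apply, Matrix.transpose_apply, Matrix.of_apply,
    Matrix.map_apply, Finset.sum_mul, map_sum (PowerSeries.coeff k), h]
  simp only [← map_sum]
  congr 1
  rw [Finset.sum_congr rfl fun _ _ => Finset.sum_comm, Finset.sum_comm]

theorem mul_smul_mul {K : Type*} [CommRing K] (l : K) (A B C : Matrix (Fin n) (Fin n) K) :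
    A * (l • B) * C = l • (A * B * C) := by
  rw [Matrix.mul_smul, Matrix.smul_mul]

theorem lam_mul_ofPowerSeries_X : lam * HahnSeries.ofPowerSeries ℂ ℂ[X] PowerSeries.X = 1 := by
  rw [lam, HahnSeries.ofPowerSeries_X, HahnSeries.single_mul_single]
  simp

/-- At most one k satisfies a + b + k = 1, and there the total exponent of λ is zero; when there is
none, c = 0. -/
theorem single_mul_lam_mul_single (a b c : ℂ)
    (hc : (∀ k : ℕ, a + b + k ≠ 1) → c = 0) :
    HahnSeries.single a (1 : ℂ[X]) * (lam * HahnSeries.ofPowerSeries ℂ ℂ[X]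
      (PowerSeries.mk fun k => Polynomial.C (if a + b + k = 1 then c else 0)))
      * HahnSeries.single b (1 : ℂ[X]) = const c := by
  by_cases h : ∃ k : ℕ, a + b + k = 1
  · obtain ⟨m, hm⟩ := h
    have h1 : (PowerSeries.mk fun k : ℕ => (Polynomial.C (if a + b + k = 1 then c else 0) : ℂ[X]))
        = PowerSeries.C (Polynomial.C c) * PowerSeries.X ^ m := by
      ext1 k
      rw [PowerSeries.coeff_mk, PowerSeries.coeff_C_mul, PowerSeries.coeff_X_pow]
      have : a + b + k = 1 ↔ k = m := by
        rw [← hm, add_right_inj, Nat.cast_inj]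
      simp only [this]
      split_ifs <;> simp
    rw [h1, map_mul, HahnSeries.ofPowerSeries_C, HahnSeries.ofPowerSeries_X_pow, lam,
      HahnSeries.C_apply]
    simp only [HahnSeries.single_mul_single]
    rw [const, RingHom.comp_apply, HahnSeries.C_apply]
    refine congrArg₂ (fun e f => HahnSeries.single e f) ?_ (by simp)
    linear_combination hm
  · rw [not_exists] at h
    rw [hc h]
    have h0 : (PowerSeries.mk fun k : ℕ => (Polynomial.C (if a + b + k = 1 then (0 : ℂ) else 0) : ℂ[X]))
        = 0 := by
      ext1 k
      simp
    rw [h0, map_zero, map_zero, mul_zero, mul_zero, zero_mul]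

theorem period_pairing
    (hU : IsEulerSystem μ R U Θ) (h0 : Θ 0 = 1) (hR : IsGraded μ R)
    (hR0 : degreePart μ 0 R = 0) (hN : IsNilpotent R) (hηU : U.transpose * η = η * U)
    (hημ : Matrix.diagonal μ * η = -(η * Matrix.diagonal μ))
    (hΘ : ∀ k : ℕ, ∑ pq ∈ Finset.HasAntidiagonal.antidiagonal k, (-1 : ℂ) ^ pq.1 •
      ((Θ pq.1).transpose * η * Θ pq.2) = if k = 0 then η else 0)
    (hRη : ∀ s : ℕ, (degreePart μ s R).transpose * η
      = (-1 : ℂ) ^ (s + 1) • (η * degreePart μ s R)) (ν : ℂ)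
    (hν : ∀ (α : Fin n) (k : ℤ), μ α + ν + 1 / 2 ≠ k)
    (hν' : ∀ (α : Fin n) (k : ℤ), μ α - ν + 1 / 2 ≠ k)
    (hRC : R.transpose * gramInv μ R η ν = -(gramInv μ R η ν * R)) :
    (Matrix.of fun γ => formalLaplace μ R (fun p α => Θ p γ α) (-ν)).transpose * η.map const
        * (U.map const - lam • (1 : Matrix (Fin n) (Fin n) LambdaSeries))
        * (Matrix.of fun γ => formalLaplace μ R (fun p α => Θ p γ α) ν)
      = (gramInv μ R η ν).map const := by
  set ι := HahnSeries.ofPowerSeries ℂ ℂ[X]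
  set c : ℂ →+* PowerSeries ℂ[X] := PowerSeries.C.comp Polynomial.C with hcdef
  have hconst : ∀ K : Matrix (Fin n) (Fin n) ℂ, K.map const = ι.mapMatrix (c.mapMatrix K) := by
    intro K
    ext1 i j
    simp [const, ι, hcdef]
  set S := laplaceSeries μ R Θ (-ν)
  set T := laplaceSeries μ R Θ ν
  set W := (S.transpose * c.mapMatrix η) *
    ((PowerSeries.X : PowerSeries ℂ[X]) • c.mapMatrix U - 1) * T with hW
  have hmid : (S.map ι).transpose * η.map const
        * (U.map const - lam • (1 : Matrix (Fin n) (Fin n) LambdaSeries)) * T.map ι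
      = lam • ι.mapMatrix W := by
    -- Factor 𝒰 - λ as λ(λ⁻¹𝒰 - 1), so that all but the scalar λ are power series in λ⁻¹.
    have h1 : U.map const - lam • (1 : Matrix (Fin n) (Fin n) LambdaSeries)
        = lam • ι.mapMatrix ((PowerSeries.X : PowerSeries ℂ[X]) • c.mapMatrix U - 1) := by
      rw [map_sub, map_one, smul_sub, hconst]
      congr 1
      ext1 i j
      simp only [RingHom.mapMatrix_apply, Matrix.map_apply, Matrix.smul_apply, smul_eq_mul, map_mul]
      rw [← mul_assoc, lam_mul_ofPowerSeries_X, one_mul]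
    rw [h1, hconst, hW, map_mul, map_mul, map_mul]
    exact mul_smul_mul lam _ _ _
  have hWc : ∀ α β, W α β = PowerSeries.mk fun k => Polynomial.C
      (if μ α + μ β + k = 0 then gramInv μ R η ν α β else 0) := by
    intro α β
    have h1 : W = (PowerSeries.X : PowerSeries ℂ[X]) •
        (S.transpose * c.mapMatrix (η * U) * T) - S.transpose * c.mapMatrix η * T := by
      rw [hW, map_mul, Matrix.mul_sub, Matrix.mul_smul, Matrix.mul_one, Matrix.sub_mul,
        Matrix.smul_mul, Matrix.mul_assoc S.transpose]
    ext1 k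
    rw [PowerSeries.coeff_mk, ← gramInv_apply hημ,
      ← laplaceCoeff_pairing_eq hU h0 hR hR0 hN hηU hημ hΘ hRη ν hν hν', h1, Matrix.sub_apply,
      Matrix.smul_apply, smul_eq_mul, map_sub, Matrix.sub_apply, map_sub]
    congr 1
    -- The 𝒰-term carries a factor λ⁻¹, so it contributes nothing for k = 0, where the corresponding
    -- sum is empty.
    · rcases k with _ | k
      · simp
      · rw [PowerSeries.coeff_succ_X_mul]
        refine (coeff_mul_const_mul _ _ _ _ _ _).trans ?_
        simp only [← Matrix.mul_assoc, Nat.add_sub_cancel]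
    · exact coeff_mul_const_mul _ _ _ _ _ _
  rw [formalLaplace_eq, formalLaplace_eq]
  have hfinal : (S.map ι * lamPowDiag μ (-ν) * (lamPowNegR R).map HahnSeries.C).transpose
        * η.map const * (U.map const - lam • (1 : Matrix (Fin n) (Fin n) LambdaSeries))
        * (T.map ι * lamPowDiag μ ν * (lamPowNegR R).map HahnSeries.C)
      = ((lamPowNegR R).map HahnSeries.C).transpose * (lamPowDiag μ (-ν) *
        ((S.map ι).transpose * η.map const
          * (U.map const - lam • (1 : Matrix (Fin n) (Fin n) LambdaSeries)) * T.map ι)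
        * lamPowDiag μ ν) * (lamPowNegR R).map HahnSeries.C := by
    simp only [Matrix.transpose_mul, Matrix.mul_assoc, lamPowDiag, Matrix.diagonal_transpose]
  have hcenter : lamPowDiag μ (-ν) * (lam • ι.mapMatrix W) * lamPowDiag μ ν
      = (gramInv μ R η ν).map const := by
    ext1 α β
    simp only [lamPowDiag, Matrix.mul_diagonal, Matrix.diagonal_mul, Matrix.smul_apply,
      RingHom.mapMatrix_apply, Matrix.map_apply, smul_eq_mul, hWc]
    -- The two shifts by 1/2 in the exponents compensate the factor λ, and ν cancels against -ν.
    have hiff : ∀ k : ℕ, μ α + μ β + k = 0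
        ↔ μ α + -ν + 1 / 2 + (μ β + ν + 1 / 2) + k = 1 := by
      intro k
      constructor <;> intro h <;> linear_combination h
    simp only [hiff]
    exact single_mul_lam_mul_single _ _ _ fun h => gramInv_apply_eq_zero hημ hR ν fun k hk =>
      h k ((hiff k).1 hk)
  rw [hfinal, hmid, hcenter]
  have h2 : (gramInv μ R η ν).map const = HahnSeries.C.mapMatrix
      ((Polynomial.C : ℂ →+* ℂ[X]).mapMatrix (gramInv μ R η ν)) := by
    ext1 i j
    simp [const]
  have h3 := congrArg (HahnSeries.C : ℂ[X] →+* LambdaSeries).mapMatrix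
    (lamPowNegR_isometry hN hRC)
  rw [map_mul, map_mul] at h3
  rw [h2]
  exact h3

end Assembly

/-! ## The geometry at a point of a flat chart -/

section FlatGeometry

variable {𝕜 : Type*} [RCLike 𝕜] {n : ℕ} {M : Type*} [TopologicalSpace M]
  [ChartedSpace (Fin n → 𝕜) M]

theorem mdifferentiable_of_mem_maximalAtlas [IsManifold 𝓘(𝕜, Fin n → 𝕜) ∞ M]
    {φ : OpenPartialHomeomorph M (Fin n → 𝕜)}
    (hφ : φ ∈ IsManifold.maximalAtlas 𝓘(𝕜, Fin n → 𝕜) ∞ M) :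
    φ.MDifferentiable 𝓘(𝕜, Fin n → 𝕜) 𝓘(𝕜, Fin n → 𝕜) :=
  ⟨(contMDiffOn_of_mem_maximalAtlas hφ).mdifferentiableOn (by simp),
    (contMDiffOn_symm_of_mem_maximalAtlas hφ).mdifferentiableOn (by simp)⟩

variable {φ : OpenPartialHomeomorph M (Fin n → 𝕜)} {v : Fin n → 𝕜}

theorem apply_eq_sum_single {V : Type*} [NormedAddCommGroup V] [NormedSpace 𝕜 V]
    (L : (Fin n → 𝕜) →L[𝕜] V) (u : Fin n → 𝕜) :
    L u = ∑ γ, u γ • L (Pi.single γ 1) := by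
  have hu : u = ∑ γ, u γ • (Pi.single γ 1 : Fin n → 𝕜) := by
    ext γ
    simp [Finset.sum_apply, Pi.single_apply]
  conv_lhs => rw [hu, map_sum]
  simp only [map_smul]

theorem sum_smul_coordVec (u : Fin n → 𝕜) :
    ∑ γ, u γ • coordVec φ v γ
      = mfderiv 𝓘(𝕜, Fin n → 𝕜) 𝓘(𝕜, Fin n → 𝕜) φ.symm v u :=
  (apply_eq_sum_single (V := Fin n → 𝕜)
    (show (Fin n → 𝕜) →L[𝕜] (Fin n → 𝕜) from
      mfderiv 𝓘(𝕜, Fin n → 𝕜) 𝓘(𝕜, Fin n → 𝕜) φ.symm v) u).symm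

theorem sum_components_smul (hφ : φ.MDifferentiable 𝓘(𝕜, Fin n → 𝕜) 𝓘(𝕜, Fin n → 𝕜))
    (hv : v ∈ φ.target) (w : TangentSpace 𝓘(𝕜, Fin n → 𝕜) (φ.symm v)) :
    ∑ γ, components φ v w γ • coordVec φ v γ = w := by
  rw [sum_smul_coordVec]
  -- The derivative of the inverse chart is taken at v, while the chain rule provides it at φ
  -- (φ.symm v); a variable point allows the substitution.
  have key : ∀ z, z = φ (φ.symm v) →
      (mfderiv 𝓘(𝕜, Fin n → 𝕜) 𝓘(𝕜, Fin n → 𝕜) φ.symm z : (Fin n → 𝕜) →L[𝕜] (Fin n → 𝕜))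
        (mfderiv 𝓘(𝕜, Fin n → 𝕜) 𝓘(𝕜, Fin n → 𝕜) φ (φ.symm v) w) = w := by
    rintro z rfl
    exact DFunLike.congr_fun (hφ.symm_comp_deriv (φ.map_target hv)) w
  exact key v (φ.right_inv hv).symm

theorem components_sum_smul (hφ : φ.MDifferentiable 𝓘(𝕜, Fin n → 𝕜) 𝓘(𝕜, Fin n → 𝕜))
    (hv : v ∈ φ.target) (u : Fin n → 𝕜) :
    components φ v (∑ γ, u γ • coordVec φ v γ) = u := by
  rw [sum_smul_coordVec]
  exact DFunLike.congr_fun (hφ.comp_symm_deriv hv) u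

namespace FrobeniusField

variable (F : FrobeniusField 𝕜 n M)

theorem isUnit_det_gram (hφ : φ.MDifferentiable 𝓘(𝕜, Fin n → 𝕜) 𝓘(𝕜, Fin n → 𝕜))
    (hv : v ∈ φ.target) : IsUnit (F.gram φ v).det := by
  rw [isUnit_iff_ne_zero]
  intro h
  obtain ⟨u, hu, h0⟩ := Matrix.exists_vecMul_eq_zero_iff.2 h
  refine hu ?_
  rw [← components_sum_smul hφ hv u, F.metric_nondegenerate (φ.symm v) (∑ γ, u γ • coordVec φ v γ)]
  · exact map_zero (mfderiv 𝓘(𝕜, Fin n → 𝕜) 𝓘(𝕜, Fin n → 𝕜) φ (φ.symm v)).toLinearMap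
  · intro b
    rw [← sum_components_smul hφ hv b]
    simp only [map_sum, map_smul, LinearMap.sum_apply, LinearMap.smul_apply, smul_eq_mul]
    refine Finset.sum_eq_zero fun β _ => ?_
    have := congrFun h0 β
    simp only [Matrix.vecMul, dotProduct, gram, Matrix.of_apply, Pi.zero_apply] at this
    rw [this, mul_zero]

theorem mul_euler_coordVec (hφ : φ.MDifferentiable 𝓘(𝕜, Fin n → 𝕜) 𝓘(𝕜, Fin n → 𝕜))
    (hv : v ∈ φ.target) (β : Fin n) :
    F.mul (φ.symm v) (F.euler (φ.symm v)) (coordVec φ v β)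
      = ∑ δ, F.multEuler φ v δ β • coordVec φ v δ := by
  conv_lhs => rw [← sum_components_smul hφ hv (F.euler (φ.symm v))]
  simp only [map_sum, map_smul, LinearMap.sum_apply, LinearMap.smul_apply, multEuler,
    Matrix.of_apply, Finset.sum_smul]
  rw [Finset.sum_comm]
  refine Finset.sum_congr rfl fun γ _ => ?_
  conv_lhs => rw [← sum_components_smul hφ hv
    (F.mul (φ.symm v) (coordVec φ v γ) (coordVec φ v β))]
  rw [Finset.smul_sum]
  simp only [smul_smul]
  rfl

/-- Invariance of the metric makes multiplication by E self-adjoint. -/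
theorem multEuler_transpose_mul_gram
    (hφ : φ.MDifferentiable 𝓘(𝕜, Fin n → 𝕜) 𝓘(𝕜, Fin n → 𝕜)) (hv : v ∈ φ.target) :
    (F.multEuler φ v).transpose * F.gram φ v = F.gram φ v * F.multEuler φ v := by
  ext α β
  have h1 : ((F.multEuler φ v).transpose * F.gram φ v) α β
      = F.metric (φ.symm v) (F.mul (φ.symm v) (F.euler (φ.symm v)) (coordVec φ v α))
        (coordVec φ v β) := by
    rw [F.mul_euler_coordVec hφ hv]
    simp [Matrix.mul_apply, gram]
  have h2 : (F.gram φ v * F.multEuler φ v) α β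
      = F.metric (φ.symm v) (coordVec φ v α)
        (F.mul (φ.symm v) (F.euler (φ.symm v)) (coordVec φ v β)) := by
    rw [F.mul_euler_coordVec hφ hv]
    simp only [Matrix.mul_apply, gram, Matrix.of_apply, map_sum, map_smul, smul_eq_mul]
    exact Finset.sum_congr rfl fun δ _ => _root_.mul_comm _ _
  rw [h1, h2, F.mul_comm, F.metric_invariant]

end FrobeniusField

variable [IsManifold 𝓘(𝕜, Fin n → 𝕜) ∞ M] {F : GeneralizedFrobeniusManifold 𝕜 n M}

namespace FlatChart

variable (φ : FlatChart F)

theorem fderiv_gram (hv : v ∈ φ.chart.target) (α β : Fin n) :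
    fderiv 𝕜 (fun w => F.gram φ.chart w α β) v = 0 := by
  have : (fun w => F.gram φ.chart w α β) =ᶠ[nhds v] fun _ => φ.η α β := by
    filter_upwards [φ.chart.open_target.mem_nhds hv] with w hw
    rw [φ.gram_eq w hw]
  rw [this.fderiv_eq]
  simp

theorem christoffel_eq_zero (hv : v ∈ φ.chart.target) (γ α β : Fin n) :
    F.christoffel φ.chart v γ α β = 0 := by
  simp [FrobeniusField.christoffel, pd, φ.fderiv_gram hv]

theorem pd_eulerComp (hv : v ∈ φ.chart.target) (γ β : Fin n) :
    pd β (fun w => F.eulerComp φ.chart w γ) v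
      = if γ = β then (2 - F.charge) / 2 - φ.μ γ else 0 := by
  have h := congrFun (congrFun (φ.mu_eq v hv) γ) β
  simp only [FrobeniusField.nablaVec, φ.christoffel_eq_zero hv, Matrix.sub_apply,
    Matrix.smul_apply, Matrix.of_apply, zero_mul, Finset.sum_const_zero, add_zero, smul_eq_mul,
    Matrix.one_apply, Matrix.diagonal_apply] at h
  split_ifs at h ⊢
  · linear_combination -h
  · linear_combination -h

/-- In flat coordinates ∇E is the Jacobian of E and η is constant, so the conformal Killing equation
loses its (2 - d) terms and only the skewness of μ is left. -/
theorem mu_add_mu_mul_eta (hv : v ∈ φ.chart.target) (α β : Fin n) :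
    (φ.μ α + φ.μ β) * φ.η α β = 0 := by
  have h := F.lie_metric φ.chart φ.mem_maximalAtlas v hv α β
  simp only [FrobeniusField.lieMetric, φ.fderiv_gram hv, zero_apply, φ.pd_eulerComp hv, ite_mul, zero_mul,
    Finset.sum_add_distrib, Finset.sum_ite_eq', Finset.mem_univ, if_true, zero_add,
    φ.gram_eq v hv] at h
  linear_combination -h

variable [NormedAlgebra 𝕜 ℂ]

theorem diagonal_muC_mul_etaC (hv : v ∈ φ.chart.target) :
    Matrix.diagonal φ.muC * φ.etaC = -(φ.etaC * Matrix.diagonal φ.muC) := by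
  ext α β
  have h := congrArg (algebraMap 𝕜 ℂ) (φ.mu_add_mu_mul_eta hv α β)
  rw [map_mul, map_add, map_zero] at h
  simp only [Matrix.diagonal_mul, Matrix.mul_diagonal, Matrix.neg_apply, muC, etaC,
    Matrix.map_apply]
  linear_combination h

theorem isUnit_det_etaC (hv : v ∈ φ.chart.target) : IsUnit φ.etaC.det := by
  have h := F.isUnit_det_gram (mdifferentiable_of_mem_maximalAtlas φ.mem_maximalAtlas) hv
  rw [φ.gram_eq v hv] at h
  have h2 := h.map (algebraMap 𝕜 ℂ)
  rwa [RingHom.map_det] at h2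

theorem multEulerC_transpose_mul_etaC (hv : v ∈ φ.chart.target) :
    (φ.multEulerC v).transpose * φ.etaC = φ.etaC * φ.multEulerC v := by
  have h := F.multEuler_transpose_mul_gram
    (mdifferentiable_of_mem_maximalAtlas φ.mem_maximalAtlas) hv
  rw [φ.gram_eq v hv] at h
  have h2 := congrArg (algebraMap 𝕜 ℂ).mapMatrix h
  rw [map_mul, map_mul] at h2
  simp only [RingHom.mapMatrix_apply, Matrix.transpose_map] at h2
  exact h2

end FlatChart

namespace DeformedFlatCoordinates

variable [NormedAlgebra 𝕜 ℂ] {φ : FlatChart F} (D : DeformedFlatCoordinates φ)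

theorem degreePart_R {s : ℕ} (hs : 1 ≤ s) : degreePart φ.muC s D.R = D.Rpart s := by
  ext α β
  rw [degreePart_apply, R, Matrix.sum_apply]
  split_ifs with h
  · by_cases hm : s ≤ D.m
    · refine Finset.sum_eq_single_of_mem s (Finset.mem_Icc.2 ⟨hs, hm⟩) fun t ht hts => ?_
      refine D.Rpart_degree t (Finset.mem_Icc.1 ht).1 α β fun h2 => hts ?_
      rw [h, add_sub_cancel_left] at h2
      exact_mod_cast h2.symm
    · rw [D.Rpart_eq_zero s (not_le.1 hm)]
      refine Finset.sum_eq_zero fun t ht => ?_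
      refine D.Rpart_degree t (Finset.mem_Icc.1 ht).1 α β fun h2 => hm ?_
      rw [h, add_sub_cancel_left] at h2
      have : s = t := by exact_mod_cast h2
      exact this ▸ (Finset.mem_Icc.1 ht).2
  · exact (D.Rpart_degree s hs α β fun h2 => h (by rw [← h2]; ring)).symm

theorem degreePart_zero_R : degreePart φ.muC 0 D.R = 0 := by
  ext α β
  rw [degreePart_apply, R, Matrix.sum_apply]
  split_ifs with h
  · refine Finset.sum_eq_zero fun t ht => ?_
    refine D.Rpart_degree t (Finset.mem_Icc.1 ht).1 α β fun h2 => ?_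
    rw [h, add_sub_cancel_left] at h2
    have : 0 = t := by exact_mod_cast h2
    have := (Finset.mem_Icc.1 ht).1
    omega
  · rfl

theorem isGraded_R : IsGraded φ.muC D.R := by
  intro α β h
  rw [R, Matrix.sum_apply] at h
  obtain ⟨t, ht, hne⟩ := Finset.exists_ne_zero_of_sum_ne_zero h
  refine ⟨t, ?_⟩
  by_contra hc
  exact hne (D.Rpart_degree t (Finset.mem_Icc.1 ht).1 α β fun h2 => hc (by rw [← h2]; ring))

theorem degreePart_R_transpose_mul (s : ℕ) :
    (degreePart φ.muC s D.R).transpose * φ.etaC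
      = (-1 : ℂ) ^ (s + 1) • (φ.etaC * degreePart φ.muC s D.R) := by
  rcases s with _ | s
  · simp [D.degreePart_zero_R]
  · rw [D.degreePart_R (by omega)]
    exact D.Rpart_eta (s + 1) (by omega)

/-- Conjugation by e^{πiμ} acts on R_s as (-1)^s, which packs the symmetries of all R_s into one
identity. -/
theorem R_transpose_mul : D.R.transpose * φ.etaC
    = -(φ.etaC * (expDiag φ.muC (Real.pi * Complex.I) * D.R
      * expDiag φ.muC (-(Real.pi * Complex.I)))) := by
  rw [R, Matrix.transpose_sum, Finset.sum_mul, Finset.mul_sum, Finset.sum_mul, Finset.mul_sum,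
    ← Finset.sum_neg_distrib]
  refine Finset.sum_congr rfl fun s hs => ?_
  have h1 := (Finset.mem_Icc.1 hs).1
  have h2 : expDiag φ.muC (Real.pi * Complex.I) * D.Rpart s
      * expDiag φ.muC (-(Real.pi * Complex.I)) = (-1 : ℂ) ^ s • D.Rpart s := by
    ext α β
    simp only [expDiag, Matrix.mul_diagonal, Matrix.diagonal_mul, Matrix.smul_apply, smul_eq_mul]
    by_cases h : φ.muC α - φ.muC β = s
    · rw [← exp_pi_I_mul_conj (show φ.muC α = φ.muC β + s by rw [← h]; ring)]
      ring
    · simp [D.Rpart_degree s h1 α β h]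
  rw [h2, D.Rpart_eta s h1, Matrix.mul_smul, pow_succ, mul_neg_one, neg_smul]

theorem isEulerSystem {v : Fin n → 𝕜} (hv : v ∈ φ.chart.target) :
    IsEulerSystem φ.muC D.R (φ.multEulerC v) (fun p => φ.gradMatrix D.θ p v) := by
  intro p
  have hsum : ∑ x ∈ Finset.HasAntidiagonal.antidiagonal (p + 1),
      φ.gradMatrix D.θ x.1 v * degreePart φ.muC x.2 D.R
      = ∑ s ∈ Finset.Icc 1 (p + 1), φ.gradMatrix D.θ (p + 1 - s) v * D.Rpart s := by
    rw [← Finset.Nat.sum_antidiagonal_swap, Finset.Nat.sum_antidiagonal_eq_sum_range_succ_mk]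
    have hsub : Finset.Icc 1 (p + 1) ⊆ Finset.range (p + 1).succ := fun s hs => by
      have := Finset.mem_Icc.1 hs
      exact Finset.mem_range.2 (by omega)
    rw [← Finset.sum_subset hsub]
    · refine Finset.sum_congr rfl fun s hs => ?_
      rw [Prod.fst_swap, Prod.snd_swap, D.degreePart_R (Finset.mem_Icc.1 hs).1]
    · intro s hs hs'
      have h0 : s = 0 := by
        have := Finset.mem_range.1 hs
        rw [Finset.mem_Icc] at hs'
        omega
      subst h0
      simp [D.degreePart_zero_R]
  ext γ α
  -- Contract the recursion ∂_ε ξ_{p+1} = ∂_ε · ξ_p with E^ε.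
  have hE : fderiv 𝕜 (fun w => φ.gradMatrix D.θ (p + 1) w γ α) v (F.eulerComp φ.chart v)
      = (φ.multEulerC v * φ.gradMatrix D.θ p v) γ α := by
    set E := F.eulerComp φ.chart v with hEdef
    rw [apply_eq_sum_single]
    have h1 : ∀ ε, fderiv 𝕜 (fun w => φ.gradMatrix D.θ (p + 1) w γ α) v (Pi.single ε 1)
        = ∑ σ, algebraMap 𝕜 ℂ (F.structConst φ.chart v γ ε σ) * φ.gradMatrix D.θ p v σ α :=
      fun ε => D.recursion v hv p ε α γ
    simp only [h1, Algebra.smul_def, Finset.mul_sum, Matrix.mul_apply, FlatChart.multEulerC,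
      Matrix.map_apply, FrobeniusField.multEuler, Matrix.of_apply, map_sum, map_mul,
      Finset.sum_mul]
    rw [Finset.sum_comm]
    simp only [mul_assoc, ← hEdef]
  rw [← hE, hsum, D.quasihomogeneity v hv (p + 1) α γ]
  simp only [Matrix.add_apply, Matrix.sub_apply, Matrix.smul_apply, Matrix.mul_diagonal,
    Matrix.diagonal_mul, Matrix.sum_apply, smul_eq_mul]
  simp only [Matrix.mul_apply]
  push_cast
  have : ∀ s δ, D.Rpart s δ α * φ.gradMatrix D.θ (p + 1 - s) v γ δ
      = φ.gradMatrix D.θ (p + 1 - s) v γ δ * D.Rpart s δ α := fun s δ => mul_comm _ _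
  simp only [this]
  ring

end DeformedFlatCoordinates

theorem exists_ne_zero_of_isUnit_det {η : Matrix (Fin n) (Fin n) ℂ} (hη : IsUnit η.det)
    (α : Fin n) : ∃ δ, η α δ ≠ 0 := by
  by_contra! h
  exact hη.ne_zero (Matrix.det_eq_zero_of_row_eq_zero α h)

end FlatGeometry

end FrobMfd

end

/-! ### The Gram matrix of the twisted periods -/

open FrobMfd in
theorem theorem6p1 {𝕜 : Type*} [RCLike 𝕜] [NormedAlgebra 𝕜 ℂ] {n : ℕ} {M : Type*}
    [TopologicalSpace M] [ChartedSpace (Fin n → 𝕜) M] [IsManifold 𝓘(𝕜, Fin n → 𝕜) ∞ M]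
    (F : GeneralizedFrobeniusManifold 𝕜 n M) (φ : FlatChart F)
    (D : DeformedFlatCoordinates φ) (v : Fin n → 𝕜) (hv : v ∈ φ.chart.target)
    (ν : ℂ) (hν : ∀ (α : Fin n) (k : ℤ), φ.muC α + ν + 1 / 2 ≠ k) :
    IsUnit (D.G ν).det ∧
    (D.periodGradient (-ν) v).transpose * φ.etaC.map const
        * ((φ.multEulerC v).map const - lam • (1 : Matrix (Fin n) (Fin n) LambdaSeries))
        * D.periodGradient ν v
      = ((D.G ν)⁻¹).map const ∧
    ((D.periodGradient (-ν) v).transpose * φ.etaC.map const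
        * ((φ.multEulerC v).map const - lam • (1 : Matrix (Fin n) (Fin n) LambdaSeries))
        * D.periodGradient ν v)⁻¹
      = (D.G ν).map const := by
  have hη := φ.isUnit_det_etaC hv
  have hημ := φ.diagonal_muC_mul_etaC hv
  have hGC : D.G ν * gramInv φ.muC D.R φ.etaC ν = 1 :=
    gramMatrix_mul_gramInv D.isGraded_R D.R_isNilpotent hη ν hν
  have hCG : gramInv φ.muC D.R φ.etaC ν * D.G ν = 1 := mul_eq_one_comm.1 hGC
  have hinv : (D.G ν)⁻¹ = gramInv φ.muC D.R φ.etaC ν := Matrix.inv_eq_right_inv hGC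
  have hGR : D.G ν * D.R.transpose = -(D.R * D.G ν) :=
    gramMatrix_mul_transpose D.isGraded_R hη ν D.R_transpose_mul
  -- Conjugate the relation G Rᵀ = -R G by C = G⁻¹ on both sides.
  have hRC : D.R.transpose * gramInv φ.muC D.R φ.etaC ν
      = -(gramInv φ.muC D.R φ.etaC ν * D.R) := by
    set C := gramInv φ.muC D.R φ.etaC ν
    calc D.R.transpose * C = C * (D.G ν * D.R.transpose) * C := by
          rw [← Matrix.mul_assoc C, hCG, Matrix.one_mul]
      _ = -(C * D.R) := by
          rw [hGR, Matrix.mul_neg, Matrix.neg_mul, ← Matrix.mul_assoc, Matrix.mul_assoc, hGC,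
            Matrix.mul_one]
  -- Nondegeneracy of η makes the spectrum of μ symmetric: some δ has μ_α = -μ_δ, and an integer
  -- value k here would give μ_δ + ν + 1/2 = 1 - k.
  have hν' : ∀ (α : Fin n) (k : ℤ), φ.muC α - ν + 1 / 2 ≠ k := by
    intro α k h
    obtain ⟨δ, hδ⟩ := exists_ne_zero_of_isUnit_det hη α
    rw [eq_neg_of_skew hημ hδ] at h
    exact hν δ (1 - k) (by push_cast; linear_combination -h)
  have hmain := period_pairing (D.isEulerSystem hv) (D.normalized v hv) D.isGraded_R
    D.degreePart_zero_R D.R_isNilpotent (φ.multEulerC_transpose_mul_etaC hv) hημ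
    (D.orthogonality v hv) D.degreePart_R_transpose_mul ν hν hν' hRC
  refine ⟨Matrix.isUnit_det_of_right_inverse hGC, hinv ▸ hmain, ?_⟩
  refine Matrix.inv_eq_right_inv ?_
  refine (congrArg (· * (D.G ν).map const) hmain).trans ?_
  have := congrArg const.mapMatrix hCG
  rwa [map_mul, map_one] at this
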